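/- **Setting.** Let $\mathcal H=\mathcal H_1\otimes\mathcal H_2$ be a finite-dimensional bipartite complex Hilbert space. For a positive semidefinite $A$, negative powers are taken with the generalized inverse (zero on $\ker A$); $\|A\|_1=\mathrm{Tr}\,(A^*A)^{1/2}$, and $\|\cdot\|$ is the operator norm. For states $\rho,\sigma$ (positive semidefinite, trace one), $\rho_1=\mathrm{Tr}_2\rho$, $\sigma_1=\mathrm{Tr}_2\sigma$, and the Petz recovery map is $\mathscr R_\rho(\gamma)=\rho^{1/2}\big(\rho_1^{-1/2}\gamma\,\rho_1^{-1/2}\otimes I\big)\rho^{1/2}$. Let $f:(0,\infty)\to\mathbb R$ be operator monotone decreasing with $f(1)=0$, and let $\mu_f$ be the positive measure in its canonical representation $$f(x)=ax+b+\int_0^\infty\Big(\frac1{t+x}-\frac t{t^2+1}\Big)d\mu_f(t),\qquad a\le 0,\ b\in\mathbb R,\ \int_0^\infty\frac{d\mu_f(t)}{t^2+1}<\infty .$$ Assume that $f$ is regular: $\mu_f$ is absolutely continuous with respect to Lebesgue measure, and for all $S,T>0$ there is a finite constant $C_{S,T}^f$ with $dt\le C_{S,T}^f\,d\mu_f(t)$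 on $[1/S,T]$. For $T>0$ let $C^f_{T,1/2}$ be the least constant such that $dt\le C^f_{T,1/2}\,d\mu_f(t)$ on $[1/T,T]$. The quasi-relative entropy is $S_f^K(\rho\|\sigma)=\mathrm{Tr}\big(\rho^{1/2}K^*f(\Delta_{\sigma,\rho})(K\rho^{1/2})\big)\in(-\infty,\infty]$, where $\Delta_{\sigma,\rho}(X)=\sigma X\rho^{-1}$. For singular $\sigma$ one puts $f(0)=f(0^+)$; if $f(0^+)=\infty$, the value is $\infty$ unless $\ker\sigma\subseteq\ker(K\rho K^*)$, in which case the components on which $f(0)$ would be evaluated vanish and contribute $0$. **Statement.** Suppose that for some $c,C>0$ one has $C^f_{T,1/2}\le C\,T^{2c}$ for all $T>0$. Let $K=K_1\otimes V$, with $K_1$ any operator on $\mathcal H_1$ and $V$ a unitary on $\mathcal H_2$. Let $\rho,\sigma$ be states on $\mathcal H$ with $\ker\rho\subseteq\ker(K^*\sigma K)$ (automatic if $\rho$ is invertible) and $S_f^K(\rho\|\sigma)<\infty$ (automatic if $\sigma$ is invertible). Then $S_f^{K_1}(\rho_1\|\sigma_1)\le S_f^K(\rho\|\sigma)$ and $$\big\|\mathscr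 R_\rho(K_1^*\sigma_1K_1)-K^*\sigma K\big\|_1\le M\,\big(S_f^K(\rho\|\sigma)-S_f^{K_1}(\rho_1\|\sigma_1)\big)^{\frac1{4(1+c)}},$$ where $M$ depends only on the smallest nonzero eigenvalue $\lambda$ of $\rho$, on $\|K\|$, $C$ and $c$; explicitly, one can take $$M=\frac{4\|K\|}{\pi}\Big(4\|K\|\big(1+\tfrac1\lambda\big)\Big)^{\frac{1+2c}{2(1+c)}}C^{\frac1{4(1+c)}} .$$ -/

import Mathlib

open MeasureTheory Matrix Set
open scoped ENNReal NNReal Kronecker ComplexOrder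

noncomputable section

namespace QuasiEntropy

/-! ### Operator monotone functions and their representing measures -/

/-- `f` is operator monotone on `(0, ∞)`: for self-adjoint operators with spectrum in `(0, ∞)` on a
complex Hilbert space, `A - B ≥ 0` implies `f(A) - f(B) ≥ 0`. -/
def OperatorMonotone (f : ℝ → ℝ) : Prop :=
  ∀ (H : Type) [NormedAddCommGroup H] [InnerProductSpace ℂ H] [CompleteSpace H]
    (A B : H →L[ℂ] H), IsSelfAdjoint A → IsSelfAdjoint B →
    spectrum ℝ A ⊆ Ioi 0 → spectrum ℝ B ⊆ Ioi 0 →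
    (A - B).IsPositive → (cfc f A - cfc f B).IsPositive

/-- `f` is operator monotone decreasing on `(0, ∞)`. -/
def OperatorMonotoneDecreasing (f : ℝ → ℝ) : Prop :=
  OperatorMonotone (fun x => -f x)

/-- `(a, b, μ)` is the canonical integral representation of `f` on `(0, ∞)`:
`f x = a x + b + ∫ (1 / (t + x) - t / (t² + 1)) dμ(t)` with `a ≤ 0` and a positive measure `μ` on
the half-line such that `∫ 1 / (t² + 1) dμ(t) < ∞`. -/
structure IsCanonicalRep (f : ℝ → ℝ) (a b : ℝ) (μ : Measure ℝ) : Prop where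
  slope_nonpos : a ≤ 0
  half_line : μ (Iio 0) = 0
  integrable : Integrable (fun t : ℝ => 1 / (t ^ 2 + 1)) μ
  eq_integral : ∀ x : ℝ, 0 < x →
    f x = a * x + b + ∫ t, (1 / (t + x) - t / (t ^ 2 + 1)) ∂μ

open Classical in
/-- The measure `μ_f` of the canonical integral representation of `f` (zero if there is none). -/
def repMeasure (f : ℝ → ℝ) : Measure ℝ :=
  if h : ∃ μ : Measure ℝ, ∃ a b : ℝ, IsCanonicalRep f a b μ then h.choose else 0

/-- A regular operator monotone decreasing function: `μ_f` is absolutely continuous, and for all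
`S, T > 0` there is a finite constant `C` with `dt ≤ C dμ_f(t)` on `[1/S, T]`. -/
structure IsRegular (f : ℝ → ℝ) : Prop where
  decreasing : OperatorMonotoneDecreasing f
  absolutelyContinuous : repMeasure f ≪ volume
  lower_bound : ∀ S T : ℝ, 0 < S → 0 < T → ∃ C : ℝ≥0,
    (volume : Measure ℝ).restrict (Icc (1 / S) T) ≤ C • (repMeasure f).restrict (Icc (1 / S) T)

/-- The cut-off `T_L(β)`. -/
def cutL (T β : ℝ) : ℝ := if β ≤ 1 / 2 then T else T ^ ((1 - β) / β)

/-- The cut-off `T_R(β)`. -/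
def cutR (T β : ℝ) : ℝ := if β ≤ 1 / 2 then T ^ (β / (1 - β)) else T

/-- `C^f_{T,β}`: the least constant with `dt ≤ C dμ_f(t)` on `[T_L(β)⁻¹, T_R(β)]`
(`∞` if there is no finite one). -/
def regConst (f : ℝ → ℝ) (T β : ℝ) : ℝ≥0∞ :=
  sInf {C : ℝ≥0∞ | (volume : Measure ℝ).restrict (Icc (cutL T β)⁻¹ (cutR T β)) ≤
    C • (repMeasure f).restrict (Icc (cutL T β)⁻¹ (cutR T β))}

/-! ### States, powers and norms of matrices -/

section Matrices

variable {ι : Type*} [Fintype ι] [DecidableEq ι]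

/-- A state: a positive semidefinite matrix of trace one. -/
structure IsState (ρ : Matrix ι ι ℂ) : Prop where
  posSemidef : ρ.PosSemidef
  trace_eq_one : ρ.trace = 1

/-- `A^{1/2}`, by functional calculus. -/
def msqrt (A : Matrix ι ι ℂ) : Matrix ι ι ℂ := cfc Real.sqrt A

/-- The generalized inverse `A⁻¹`: inverse on the nonzero eigenvalues, zero on the kernel. -/
def ginv (A : Matrix ι ι ℂ) : Matrix ι ι ℂ := cfc (fun x : ℝ => x⁻¹) A

/-- `A^{-1/2}`, with the generalized inverse: zero on the kernel. -/
def ginvSqrt (A : Matrix ι ι ℂ) : Matrix ι ι ℂ := cfc (fun x : ℝ => (Real.sqrt x)⁻¹) A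

/-- The trace norm `Tr |A|` with `|A| = (A* A)^{1/2}`. -/
def traceNorm (A : Matrix ι ι ℂ) : ℝ := (msqrt (Aᴴ * A)).trace.re

/-- The operator norm of a matrix acting on the Euclidean space `ℂ^ι`. -/
def opNorm (A : Matrix ι ι ℂ) : ℝ := ‖Matrix.toEuclideanCLM (n := ι) (𝕜 := ℂ) A‖

/-- The smallest nonzero eigenvalue (the set is finite, and nonempty for a state). -/
def minNonzeroEigenvalue (A : Matrix ι ι ℂ) : ℝ := sInf {x : ℝ | x ∈ spectrum ℝ A ∧ x ≠ 0}

/-! ### The relative modular operator and the quasi-relative entropy -/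

/-- The relative modular operator `Δ_{A,B}(X) = A X B⁻¹`, with the generalized inverse of `B`. -/
def modularOp (A B : Matrix ι ι ℂ) : Matrix ι ι ℂ →ₗ[ℂ] Matrix ι ι ℂ :=
  LinearMap.mulLeft ℂ A ∘ₗ LinearMap.mulRight ℂ (ginv B)

/-- Functional calculus `f(Φ)` of a linear operator on the Hilbert space of matrices with the
Hilbert-Schmidt inner product, computed in the orthonormal basis of matrix units. -/
def superCfc (f : ℝ → ℝ) (Φ : Matrix ι ι ℂ →ₗ[ℂ] Matrix ι ι ℂ) :
    Matrix ι ι ℂ →ₗ[ℂ] Matrix ι ι ℂ :=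
  Matrix.toLin (Matrix.stdBasis ℂ ι ι) (Matrix.stdBasis ℂ ι ι)
    (cfc f (LinearMap.toMatrix (Matrix.stdBasis ℂ ι ι) (Matrix.stdBasis ℂ ι ι) Φ))

/-- A decreasing function on `(0, ∞)` extended to `0` by `f(0) = f(0+) = sup f`
(only relevant when the supremum is finite). -/
def extZero (f : ℝ → ℝ) : ℝ → ℝ := Function.update f 0 (sSup (f '' Ioi 0))

open Classical in
/-- The quasi-relative entropy `S_f^K(ρ‖σ) = Tr(ρ^{1/2} K* f(Δ_{σ,ρ})(K ρ^{1/2}))`, with values in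
`(-∞, ∞]`. For singular `σ` the convention is `f(0) = f(0+)`: if `f(0+) = ∞`, the value is `∞`
unless the vector `K ρ^{1/2}` has no component on which `f(0)` would be evaluated, that is, unless
the kernel of `σ` lies in the kernel of `K ρ K*`. -/
def quasiEntropy (f : ℝ → ℝ) (K ρ σ : Matrix ι ι ℂ) : EReal :=
  if BddAbove (f '' Ioi 0) ∨ ∀ x : ι → ℂ, σ *ᵥ x = 0 → (K * ρ * Kᴴ) *ᵥ x = 0 then
    (((msqrt ρ * Kᴴ * superCfc (extZero f) (modularOp σ ρ) (K * msqrt ρ)).trace.re : ℝ) : EReal)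
  else ⊤

end Matrices

/-! ### Bipartite systems -/

section Bipartite

variable {m n : Type*} [Fintype m] [DecidableEq m] [Fintype n] [DecidableEq n]

/-- The partial trace over the second factor. -/
def ptrace₂ (ρ : Matrix (m × n) (m × n) ℂ) : Matrix m m ℂ :=
  Matrix.of fun i j => ∑ k, ρ (i, k) (j, k)

/-- The Petz recovery map
`γ ↦ ρ^{1/2} (ρ₁^{-1/2} γ ρ₁^{-1/2} ⊗ 1) ρ^{1/2}`. -/
def petzMap (ρ : Matrix (m × n) (m × n) ℂ) (γ : Matrix m m ℂ) : Matrix (m × n) (m × n) ℂ :=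
  msqrt ρ * ((ginvSqrt (ptrace₂ ρ) * γ * ginvSqrt (ptrace₂ ρ)) ⊗ₖ (1 : Matrix n n ℂ)) * msqrt ρ

end Bipartite

/-- The constant `M` as a function of the smallest nonzero eigenvalue `lam` of `ρ`, of `k = ‖K‖`,
and of `C` and `c`. -/
def recoveryConst (lam k C c : ℝ) : ℝ :=
  4 * k / Real.pi * (4 * k * (1 + 1 / lam)) ^ ((1 + 2 * c) / (2 * (1 + c))) *
    C ^ (1 / (4 * (1 + c)))

end QuasiEntropy

end

set_option linter.unusedSectionVars false

/-! On Hilbert-Schmidt space put `A = Δ_{σ,ρ}`, `v = K ρ^{1/2}`, and on the reduced system `A' =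
Δ_{σ₁,ρ₁}`, `v' = K₁ ρ₁^{1/2}`. The map `W X = (X ρ₁^{-1/2} ⊗ V) ρ^{1/2}` is a contraction with `W*
A W ≤ A'`, `W v' = v` and `W* v = v'` (`compression_liftMap`). Completing the square at the
resolvent vectors then shows that the defect `⟨v, (t+A)⁻¹ v⟩ - ⟨v', (t+A')⁻¹ v'⟩` dominates `t ‖W
(t+A')⁻¹ v' - (t+A)⁻¹ v‖²` (`Compression.resolvent_bound`). Integrated against `μ_f`, these defects
give exactly the entropy difference `D`, because the affine parts of the representation cancel. This
is monotonicity, with a remainder.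

The remainder controls square roots through `π √x = ∫ √t (1/t - 1/(t+x)) dt`. Truncation to `[1/T,
T]` costs `O(T^{-1/2})`. On that interval Cauchy-Schwarz and regularity bound the rest by `(C
D)^{1/2} T^{1/2+c}`, and the choice of `T` gives the exponent
(`Compression.norm_sqrt_diff_le_defect`).

Finally `A^{1/2} v = σ^{1/2} K` and `W A'^{1/2} v' = W(σ₁^{1/2} K₁)`. Their squares `X* X` are `K* σ
K` and the recovered operator, so `traceNorm_sub_le` turns Hilbert-Schmidt closeness into the trace
norm estimate. -/

namespace QuasiEntropy

/-! ### Functional calculus in an explicit orthonormal eigenbasis -/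

section Spectral

variable {I E : Type*} [Fintype I] [NormedAddCommGroup E] [InnerProductSpace ℂ E]

/-- The operator with eigenbasis `e` and eigenvalues `g (l i)`, applied to `v`. -/
noncomputable def specApply (e : OrthonormalBasis I ℂ E) (l : I → ℝ) (g : ℝ → ℝ) (v : E) : E :=
  ∑ i, g (l i) • (inner ℂ (e i) v • e i)

/-- The quadratic form of the operator with eigenbasis `e` and eigenvalues `g (l i)`. -/
noncomputable def specForm (e : OrthonormalBasis I ℂ E) (l : I → ℝ) (g : ℝ → ℝ) (v : E) : ℝ :=
  ∑ i, g (l i) * ‖inner ℂ (e i) v‖ ^ 2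

variable (e : OrthonormalBasis I ℂ E) (l : I → ℝ)

theorem inner_specApply (g : ℝ → ℝ) (v : E) (i : I) :
    inner ℂ (e i) (specApply e l g v) = (g (l i) : ℂ) * inner ℂ (e i) v := by
  classical
  simp only [specApply, inner_sum, inner_smul_right, RCLike.real_smul_eq_coe_smul (K := ℂ),
    orthonormal_iff_ite.mp e.orthonormal]
  simp

theorem norm_sq_eq_specForm (v : E) : ‖v‖ ^ 2 = specForm e l (fun _ => 1) v := by
  simp [specForm, e.sum_sq_norm_inner_right]

theorem norm_specApply_sq (g : ℝ → ℝ) (v : E) :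
    ‖specApply e l g v‖ ^ 2 = specForm e l (fun x => g x ^ 2) v := by
  rw [norm_sq_eq_specForm e l]
  simp only [specForm, inner_specApply, norm_mul, mul_pow]
  simp

theorem specForm_nonneg {g : ℝ → ℝ} (v : E) (H : ∀ i, 0 ≤ g (l i)) : 0 ≤ specForm e l g v :=
  Finset.sum_nonneg fun i _ => mul_nonneg (H i) (by positivity)

theorem specForm_mono {g h : ℝ → ℝ} (v : E) (H : ∀ i, g (l i) ≤ h (l i)) :
    specForm e l g v ≤ specForm e l h v :=
  Finset.sum_le_sum fun i _ => mul_le_mul_of_nonneg_right (H i) (by positivity)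

theorem norm_specApply_le {g h : ℝ → ℝ} (v : E) (H : ∀ i, |g (l i)| ≤ h (l i)) :
    ‖specApply e l g v‖ ≤ ‖specApply e l h v‖ := by
  refine le_of_sq_le_sq ?_ (norm_nonneg _)
  rw [norm_specApply_sq, norm_specApply_sq]
  refine specForm_mono e l v fun i => ?_
  rw [← sq_abs]
  exact pow_le_pow_left₀ (abs_nonneg _) (H i) 2

theorem specApply_add (g h : ℝ → ℝ) (v : E) :
    specApply e l (fun x => g x + h x) v = specApply e l g v + specApply e l h v := by
  simp [specApply, add_smul, Finset.sum_add_distrib]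

theorem specApply_sub (g h : ℝ → ℝ) (v : E) :
    specApply e l (fun x => g x - h x) v = specApply e l g v - specApply e l h v := by
  simp [specApply, sub_smul, Finset.sum_sub_distrib]

theorem specApply_const_mul (c : ℝ) (g : ℝ → ℝ) (v : E) :
    specApply e l (fun x => c * g x) v = c • specApply e l g v := by
  simp [specApply, mul_smul, Finset.smul_sum]

theorem specApply_one (v : E) : specApply e l (fun _ => 1) v = v := by
  simpa [specApply] using e.sum_repr' v

theorem re_inner_specApply (g : ℝ → ℝ) (v : E) :
    (inner ℂ (specApply e l g v) v).re = specForm e l g v := by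
  rw [← e.sum_inner_mul_inner, Complex.re_sum]
  refine Finset.sum_congr rfl fun i _ => ?_
  rw [← inner_conj_symm, inner_specApply, map_mul, Complex.conj_ofReal, mul_assoc,
    Complex.conj_mul', ← Complex.ofReal_pow, ← Complex.ofReal_mul, Complex.ofReal_re]

/-- Completing the square for the form of `t + A` around the resolvent vector `(t + A)⁻¹ v`. -/
theorem specForm_sub_resolvent (hl : ∀ i, 0 ≤ l i) {t : ℝ} (ht : 0 < t) (x v : E) :
    specForm e l (fun y => t + y) (x - specApply e l (fun y => 1 / (t + y)) v) =
      specForm e l (fun y => t + y) x - 2 * (inner ℂ x v).re +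
        specForm e l (fun y => 1 / (t + y)) v := by
  rw [← e.sum_inner_mul_inner x v, Complex.re_sum]
  simp only [specForm]
  rw [Finset.mul_sum, ← Finset.sum_sub_distrib, ← Finset.sum_add_distrib]
  refine Finset.sum_congr rfl fun i _ => ?_
  have hp : 0 < t + l i := by linarith [hl i]
  rw [inner_sub_right, inner_specApply, ← inner_conj_symm x (e i)]
  generalize inner ℂ (e i) x = a
  generalize inner ℂ (e i) v = b
  simp only [← Complex.normSq_eq_norm_sq, Complex.normSq_apply, Complex.sub_re, Complex.sub_im,
    Complex.mul_re, Complex.mul_im, Complex.ofReal_re, Complex.ofReal_im, Complex.conj_re,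
    Complex.conj_im]
  field_simp
  ring

theorem specForm_resolvent (hl : ∀ i, 0 ≤ l i) {t : ℝ} (ht : 0 < t) (v : E) :
    specForm e l (fun y => t + y) (specApply e l (fun y => 1 / (t + y)) v) =
      specForm e l (fun y => 1 / (t + y)) v := by
  simp only [specForm, inner_specApply, norm_mul, mul_pow]
  refine Finset.sum_congr rfl fun i _ => ?_
  have hp : 0 < t + l i := by linarith [hl i]
  simp only [Complex.norm_real, Real.norm_eq_abs, sq_abs]
  field_simp

theorem specForm_add_id (t : ℝ) (x : E) :
    specForm e l (fun y => t + y) x = t * ‖x‖ ^ 2 + specForm e l id x := by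
  rw [norm_sq_eq_specForm e l]
  simp [specForm, add_mul, Finset.sum_add_distrib, Finset.mul_sum]

end Spectral

/-! ### Resolvent vectors under a compression -/

section Resolvent

variable {I J E F : Type*} [Fintype I] [Fintype J] [NormedAddCommGroup E] [InnerProductSpace ℂ E]
  [NormedAddCommGroup F] [InnerProductSpace ℂ F]

/-- The setting of a contraction `W` between two Hilbert spaces carrying positive operators
`A` and `A'`, with `W* A W ≤ A'` and matching vectors `W v' = v`, `W* v = v'`. -/
structure Compression (e : OrthonormalBasis I ℂ E) (l : I → ℝ) (e' : OrthonormalBasis J ℂ F)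
    (l' : J → ℝ) (W : F →ₗ[ℂ] E) (v : E) (v' : F) : Prop where
  nonneg : ∀ i, 0 ≤ l i
  nonneg' : ∀ j, 0 ≤ l' j
  contraction : ∀ x, ‖W x‖ ≤ ‖x‖
  form_le : ∀ x, specForm e l id (W x) ≤ specForm e' l' id x
  map_vec : W v' = v
  adjoint_vec : ∀ x, inner ℂ (W x) v = inner ℂ x v'

variable {e : OrthonormalBasis I ℂ E} {l : I → ℝ} {e' : OrthonormalBasis J ℂ F} {l' : J → ℝ}
  {W : F →ₗ[ℂ] E} {v : E} {v' : F}

theorem Compression.norm_eq (h : Compression e l e' l' W v v') : ‖v‖ ^ 2 = ‖v'‖ ^ 2 := by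
  have := h.adjoint_vec v'
  rw [h.map_vec, inner_self_eq_norm_sq_to_K, inner_self_eq_norm_sq_to_K] at this
  exact_mod_cast this

/-- The resolvent entropy defect controls the resolvent difference. -/
theorem Compression.resolvent_bound (h : Compression e l e' l' W v v') {t : ℝ} (ht : 0 < t) :
    t * ‖W (specApply e' l' (fun y => 1 / (t + y)) v') -
        specApply e l (fun y => 1 / (t + y)) v‖ ^ 2 ≤
      specForm e l (fun y => 1 / (t + y)) v - specForm e' l' (fun y => 1 / (t + y)) v' := by
  -- The completed square is evaluated at `W x`. Since `W* v = v'`, its cross term is `⟨v', (t+A')⁻¹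
  -- v'⟩`, which is also the value of the form of `t + A'` at `x`. On the left, dropping `A ≥ 0`
  -- leaves `t` times the squared norm.
  set x := specApply e' l' (fun y => 1 / (t + y)) v' with hx
  have h1 := specForm_sub_resolvent e l h.nonneg ht (W x) v
  have h2 := specForm_resolvent e' l' h.nonneg' ht v'
  have h3 := re_inner_specApply e' l' (fun y => 1 / (t + y)) v'
  rw [h.adjoint_vec, specForm_add_id, specForm_add_id] at h1
  rw [specForm_add_id] at h2
  rw [← hx] at h2 h3
  have h4 := h.form_le x
  have h5 : t * ‖W x‖ ^ 2 ≤ t * ‖x‖ ^ 2 := by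
    have := h.contraction x
    gcongr
  have h6 := specForm_nonneg e l (g := id)
    (W x - specApply e l (fun y => 1 / (t + y)) v) h.nonneg
  linarith

end Resolvent

/-! ### Integral representation of the square root and its truncation -/

section SqrtIntegral

/-- The integrand of the integral representation of `π √x`. -/
noncomputable def sqrtKernel (t x : ℝ) : ℝ := Real.sqrt t * (1 / t - 1 / (t + x))

theorem continuousOn_sqrtKernel {x : ℝ} (hx : 0 ≤ x) :
    ContinuousOn (fun t => sqrtKernel t x) (Ioi 0) := by
  unfold sqrtKernel
  refine ContinuousOn.mul (Real.continuous_sqrt.continuousOn) (ContinuousOn.sub ?_ ?_)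
  · exact continuousOn_const.div continuousOn_id fun t ht => ne_of_gt ht
  · refine continuousOn_const.div (by fun_prop) fun t ht => ?_
    have : (0 : ℝ) < t := ht
    positivity

theorem intervalIntegral_sqrtKernel {x : ℝ} (hx : 0 < x) {a b : ℝ} (ha : 0 < a) (hab : a ≤ b) :
    ∫ t in a..b, sqrtKernel t x =
      2 * Real.sqrt x * (Real.arctan (Real.sqrt b / Real.sqrt x) -
        Real.arctan (Real.sqrt a / Real.sqrt x)) := by
  have hsub : uIcc a b ⊆ Ioi 0 := by
    rw [uIcc_of_le hab]; exact fun t ht => lt_of_lt_of_le ha ht.1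
  rw [mul_sub]
  refine intervalIntegral.integral_eq_sub_of_hasDerivAt
    (f := fun t => 2 * Real.sqrt x * Real.arctan (Real.sqrt t / Real.sqrt x)) ?_ ?_
  · intro t ht
    have ht0 : 0 < t := hsub ht
    have h1 := (((Real.hasDerivAt_sqrt ht0.ne').div_const (Real.sqrt x)).arctan).const_mul
      (2 * Real.sqrt x)
    refine h1.congr_deriv ?_
    have hsx : 0 < Real.sqrt x := Real.sqrt_pos.mpr hx
    have hst : 0 < Real.sqrt t := Real.sqrt_pos.mpr ht0
    have e1 : t = Real.sqrt t ^ 2 := (Real.sq_sqrt ht0.le).symm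
    have e2 : x = Real.sqrt x ^ 2 := (Real.sq_sqrt hx.le).symm
    unfold sqrtKernel
    generalize Real.sqrt x = r at *
    generalize Real.sqrt t = s at *
    subst e1 e2
    have : s ^ 2 + r ^ 2 ≠ 0 := by positivity
    have : 1 + (s / r) ^ 2 ≠ 0 := by positivity
    field_simp
    ring
  · exact ((continuousOn_sqrtKernel hx.le).mono hsub).intervalIntegrable

theorem arctan_le_self_of_nonneg {x : ℝ} (hx : 0 ≤ x) : Real.arctan x ≤ x := by
  rcases hx.eq_or_lt with rfl | h
  · simp
  · have h1 : 0 < Real.arctan x := Real.arctan_pos.mpr h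
    have := Real.lt_tan h1 (Real.arctan_lt_pi_div_two x)
    rw [Real.tan_arctan] at this
    exact this.le

/-- Error of truncating the integral representation of `π √x` to `[1/T, T]`. -/
theorem abs_pi_sqrt_sub_le {x : ℝ} (hx : 0 ≤ x) {T : ℝ} (hT : 1 ≤ T) :
    |Real.pi * Real.sqrt x - ∫ t in T⁻¹..T, sqrtKernel t x| ≤ 2 / Real.sqrt T * (1 + x) := by
  have hT0 : 0 < T := by linarith
  rcases hx.eq_or_lt with rfl | hx
  · have : ∀ t, sqrtKernel t 0 = 0 := by intro t; simp [sqrtKernel]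
    simp only [this]
    simp only [Real.sqrt_zero, mul_zero, intervalIntegral.integral_zero, sub_zero, abs_zero]
    positivity
  have hle : T⁻¹ ≤ T := (inv_le_one_of_one_le₀ hT).trans hT
  rw [intervalIntegral_sqrtKernel hx (by positivity) hle]
  have hsx : 0 < Real.sqrt x := Real.sqrt_pos.mpr hx
  have hsT : 0 < Real.sqrt T := Real.sqrt_pos.mpr hT0
  have e2 : Real.sqrt x ^ 2 = x := (Real.sq_sqrt hx.le)
  -- Reflecting the arctangent at the upper endpoint isolates `π √x`; both remaining arctangents
  -- have small arguments and are bounded by them.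
  have h1 : Real.arctan (Real.sqrt T / Real.sqrt x) =
      Real.pi / 2 - Real.arctan (Real.sqrt x / Real.sqrt T) := by
    rw [← Real.arctan_inv_of_pos (by positivity), inv_div]
  rw [h1, Real.sqrt_inv]
  have h2 := arctan_le_self_of_nonneg (x := Real.sqrt x / Real.sqrt T) (by positivity)
  have h3 := arctan_le_self_of_nonneg (x := (Real.sqrt T)⁻¹ / Real.sqrt x) (by positivity)
  have h4 : 0 ≤ Real.arctan (Real.sqrt x / Real.sqrt T) := Real.arctan_nonneg.mpr (by positivity)
  have h5 : 0 ≤ Real.arctan ((Real.sqrt T)⁻¹ / Real.sqrt x) :=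
    Real.arctan_nonneg.mpr (by positivity)
  have h6 : Real.pi * Real.sqrt x - 2 * Real.sqrt x * (Real.pi / 2 -
      Real.arctan (Real.sqrt x / Real.sqrt T) - Real.arctan ((Real.sqrt T)⁻¹ / Real.sqrt x)) =
      2 * Real.sqrt x * (Real.arctan (Real.sqrt x / Real.sqrt T) +
        Real.arctan ((Real.sqrt T)⁻¹ / Real.sqrt x)) := by ring
  rw [h6, abs_of_nonneg (by positivity)]
  calc _ ≤ 2 * Real.sqrt x * (Real.sqrt x / Real.sqrt T + (Real.sqrt T)⁻¹ / Real.sqrt x) := by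
        gcongr
    _ = 2 / Real.sqrt T * (1 + Real.sqrt x ^ 2) := by field_simp; ring
    _ = _ := by rw [e2]

/-- For cut-offs `T ≤ 1` the zero function is already a good enough approximant, by `π ≤ 4` and `√x
≤ (1 + x) / 2`. The later optimization over `T` is therefore unconstrained. -/
theorem abs_pi_sqrt_le {x : ℝ} (hx : 0 ≤ x) {T : ℝ} (hT0 : 0 < T) (hT : T ≤ 1) :
    |Real.pi * Real.sqrt x| ≤ 2 / Real.sqrt T * (1 + x) := by
  have hs : Real.sqrt T ≤ 1 := by simpa using Real.sqrt_le_sqrt hT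
  have hsT : 0 < Real.sqrt T := Real.sqrt_pos.mpr hT0
  have h1 : 2 ≤ 2 / Real.sqrt T := by rw [le_div_iff₀ hsT]; linarith
  rw [abs_of_nonneg (by positivity)]
  have h2 := Real.sq_sqrt hx
  have h3 : Real.sqrt x ≤ (1 + x) / 2 := by nlinarith [sq_nonneg (Real.sqrt x - 1)]
  calc _ ≤ 4 * ((1 + x) / 2) := mul_le_mul Real.pi_le_four h3 (Real.sqrt_nonneg _) (by norm_num)
    _ = 2 * (1 + x) := by ring
    _ ≤ _ := by gcongr

end SqrtIntegral

/-! ### Optimization of the cut-off and Cauchy-Schwarz on an interval -/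

section RealLemmas

/-- The two terms balance at `T = (A / B)^{1/(1+c)}`, whence the factor 2. If `A = 0` or `B = 0` no
optimum exists, and `T → 0` or `T → ∞` replaces it. -/
theorem le_of_forall_cutoff {y A B c : ℝ} (hA : 0 ≤ A) (hB : 0 ≤ B) (hc : 0 < c)
    (h : ∀ T : ℝ, 0 < T → y ≤ A / Real.sqrt T + B * T ^ (1 / 2 + c)) :
    y ≤ 2 * A ^ ((1 + 2 * c) / (2 * (1 + c))) * B ^ (1 / (2 * (1 + c))) := by
  rcases hA.eq_or_lt with rfl | hA
  · rw [Real.zero_rpow (by positivity), mul_zero, zero_mul]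
    have h1 : Filter.Tendsto (fun T : ℝ => B * T ^ (1 / 2 + c)) (nhdsWithin 0 (Ioi 0))
        (nhds (B * 0 ^ (1 / 2 + c))) :=
      ((Real.continuousAt_rpow_const 0 (1 / 2 + c) (Or.inr (by positivity))).tendsto.mono_left
        nhdsWithin_le_nhds).const_mul B
    rw [Real.zero_rpow (by positivity), mul_zero] at h1
    refine ge_of_tendsto h1 ?_
    filter_upwards [self_mem_nhdsWithin] with T hT
    simpa using h T hT
  rcases hB.eq_or_lt with rfl | hB
  · rw [Real.zero_rpow (x := 1 / (2 * (1 + c))) (by positivity), mul_zero]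
    have h1 : Filter.Tendsto (fun T : ℝ => A / Real.sqrt T) Filter.atTop (nhds 0) :=
      Filter.Tendsto.div_atTop tendsto_const_nhds Real.tendsto_sqrt_atTop
    refine ge_of_tendsto h1 ?_
    filter_upwards [Filter.eventually_gt_atTop 0] with T hT
    simpa using h T hT
  have hAB : 0 < A / B := by positivity
  refine (h ((A / B) ^ (1 / (1 + c))) (by positivity)).trans (le_of_eq ?_)
  rw [Real.sqrt_eq_rpow, ← Real.rpow_mul hAB.le, ← Real.rpow_mul hAB.le]
  rw [Real.div_rpow hA.le hB.le, Real.div_rpow hA.le hB.le]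
  have e1 : A ^ ((1 + 2 * c) / (2 * (1 + c))) * A ^ (1 / (1 + c) * (1 / 2)) = A := by
    rw [← Real.rpow_add hA]
    convert Real.rpow_one A using 2
    field_simp
    ring
  have e2 : A ^ (1 / (1 + c) * (1 / 2 + c)) = A ^ ((1 + 2 * c) / (2 * (1 + c))) := by
    congr 1
    field_simp
  have e3 : B ^ (1 / (2 * (1 + c))) = B ^ (1 / (1 + c) * (1 / 2)) := by
    congr 1
    field_simp
  have e4 : B ^ (1 / (2 * (1 + c))) * B ^ (1 / (1 + c) * (1 / 2 + c)) = B := by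
    rw [← Real.rpow_add hB]
    convert Real.rpow_one B using 2
    field_simp
    ring
  rw [e2, ← e3]
  rw [← e3] at *
  have p1 : 0 < A ^ (1 / (1 + c) * (1 / 2)) := by positivity
  have p2 : 0 < B ^ (1 / (1 + c) * (1 / 2 + c)) := by positivity
  have p3 : 0 < B ^ (1 / (2 * (1 + c))) := by positivity
  have f1 : A / (A ^ (1 / (1 + c) * (1 / 2)) / B ^ (1 / (2 * (1 + c)))) =
      A ^ ((1 + 2 * c) / (2 * (1 + c))) * B ^ (1 / (2 * (1 + c))) := by
    rw [div_div_eq_mul_div, div_eq_iff p1.ne']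
    linear_combination (-B ^ (1 / (2 * (1 + c)))) * e1
  have f2 : B * (A ^ ((1 + 2 * c) / (2 * (1 + c))) / B ^ (1 / (1 + c) * (1 / 2 + c))) =
      A ^ ((1 + 2 * c) / (2 * (1 + c))) * B ^ (1 / (2 * (1 + c))) := by
    rw [← mul_div_assoc, div_eq_iff p2.ne']
    linear_combination (-A ^ ((1 + 2 * c) / (2 * (1 + c)))) * e4
  rw [f1, f2]
  ring

/-- Cauchy-Schwarz against the constant 1, obtained from the nonnegative variance of `g` about its
mean. -/
theorem sq_intervalIntegral_le {g : ℝ → ℝ} {a b : ℝ} (hab : a ≤ b)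
    (hg : ContinuousOn g (Icc a b)) :
    (∫ t in a..b, g t) ^ 2 ≤ (b - a) * ∫ t in a..b, g t ^ 2 := by
  rcases hab.eq_or_lt with rfl | hab'
  · simp
  rw [← uIcc_of_le hab] at hg
  have i1 : IntervalIntegrable g volume a b := hg.intervalIntegrable
  have i2 : IntervalIntegrable (fun t => g t ^ 2) volume a b := (hg.pow 2).intervalIntegrable
  set m := (∫ t in a..b, g t) / (b - a) with hm
  have hba : 0 < b - a := by linarith
  have h1 : 0 ≤ ∫ t in a..b, (g t - m) ^ 2 :=
    intervalIntegral.integral_nonneg hab fun t _ => sq_nonneg _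
  have h2 : ∫ t in a..b, (g t - m) ^ 2 =
      (∫ t in a..b, g t ^ 2) - 2 * m * (∫ t in a..b, g t) + (b - a) * m ^ 2 := by
    have : ∀ t, (g t - m) ^ 2 = g t ^ 2 - 2 * m * g t + m ^ 2 := fun t => by ring
    simp only [this]
    rw [intervalIntegral.integral_add (i2.sub (i1.const_mul _)) intervalIntegrable_const,
      intervalIntegral.integral_sub i2 (i1.const_mul _), intervalIntegral.integral_const_mul]
    simp
  have h3 : ∫ t in a..b, g t = m * (b - a) := by rw [hm]; field_simp
  rw [h2] at h1
  rw [h3] at h1 ⊢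
  nlinarith

end RealLemmas

/-! ### From resolvents to truncated square roots -/

section Truncation

variable {I J E F : Type*} [Fintype I] [Fintype J] [NormedAddCommGroup E] [InnerProductSpace ℂ E]
  [NormedAddCommGroup F] [InnerProductSpace ℂ F]

/-- The difference of the resolvent vectors. -/
noncomputable def resolventDiff (e : OrthonormalBasis I ℂ E) (l : I → ℝ)
    (e' : OrthonormalBasis J ℂ F) (l' : J → ℝ) (W : F →ₗ[ℂ] E) (v : E) (v' : F) (t : ℝ) : E :=
  W (specApply e' l' (fun y => 1 / (t + y)) v') - specApply e l (fun y => 1 / (t + y)) v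

variable {e : OrthonormalBasis I ℂ E} {l : I → ℝ} {e' : OrthonormalBasis J ℂ F} {l' : J → ℝ}
  {W : F →ₗ[ℂ] E} {v : E} {v' : F}

theorem map_specApply (g : ℝ → ℝ) :
    W (specApply e' l' g v') = ∑ j, g (l' j) • W (inner ℂ (e' j) v' • e' j) := by
  rw [specApply, map_sum]
  refine Finset.sum_congr rfl fun j _ => ?_
  rw [RCLike.real_smul_eq_coe_smul (K := ℂ), map_smul, ← RCLike.real_smul_eq_coe_smul (K := ℂ)]

theorem Compression.continuousOn_resolventDiff (h : Compression e l e' l' W v v') :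
    ContinuousOn (resolventDiff e l e' l' W v v') (Ioi 0) := by
  have key : ∀ x : ℝ, 0 ≤ x → ContinuousOn (fun t : ℝ => 1 / (t + x)) (Ioi 0) := by
    intro x hx
    refine continuousOn_const.div (by fun_prop) fun t ht => ?_
    have : (0 : ℝ) < t := ht
    positivity
  unfold resolventDiff
  simp only [map_specApply]
  refine ContinuousOn.sub ?_ ?_
  · exact continuousOn_finsetSum _ fun j _ => (key _ (h.nonneg' j)).smul continuousOn_const
  · exact continuousOn_finsetSum _ fun i _ => (key _ (h.nonneg i)).smul continuousOn_const

variable [CompleteSpace E]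

/-- The `1/t` part of the kernel acts as a scalar and drops out because `W v' = v`, so only
resolvent differences remain. -/
theorem Compression.truncated_eq (h : Compression e l e' l' W v v') {a b : ℝ} (ha : 0 < a)
    (hab : a ≤ b) :
    specApply e l (fun x => ∫ t in a..b, sqrtKernel t x) v -
        W (specApply e' l' (fun x => ∫ t in a..b, sqrtKernel t x) v') =
      ∫ t in a..b, Real.sqrt t • resolventDiff e l e' l' W v v' t := by
  have hsub : uIcc a b ⊆ Ioi 0 := by
    rw [uIcc_of_le hab]; exact fun t ht => lt_of_lt_of_le ha ht.1
  have hk : ∀ x : ℝ, 0 ≤ x → ∀ y : E,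
      IntervalIntegrable (fun t => sqrtKernel t x • y) volume a b :=
    fun x hx y =>
      (((continuousOn_sqrtKernel hx).mono hsub).smul continuousOn_const).intervalIntegrable
  have e1 : ∀ t, Real.sqrt t • resolventDiff e l e' l' W v v' t =
      specApply e l (fun x => sqrtKernel t x) v -
        W (specApply e' l' (fun x => sqrtKernel t x) v') := by
    intro t
    have hv : specApply e l (fun x => sqrtKernel t x) v =
        (Real.sqrt t * (1 / t)) • v - Real.sqrt t • specApply e l (fun y => 1 / (t + y)) v := by
      unfold sqrtKernel
      simp only [mul_sub]
      rw [specApply_sub, specApply_const_mul e l _ (fun y => 1 / (t + y))]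
      congr 1
      have := specApply_const_mul e l (Real.sqrt t * (1 / t)) (fun _ => 1) v
      rw [specApply_one] at this
      simpa using this
    have hv' : specApply e' l' (fun x => sqrtKernel t x) v' =
        (Real.sqrt t * (1 / t)) • v' -
          Real.sqrt t • specApply e' l' (fun y => 1 / (t + y)) v' := by
      unfold sqrtKernel
      simp only [mul_sub]
      rw [specApply_sub, specApply_const_mul e' l' _ (fun y => 1 / (t + y))]
      congr 1
      have := specApply_const_mul e' l' (Real.sqrt t * (1 / t)) (fun _ => 1) v'
      rw [specApply_one] at this
      simpa using this
    have hr : ∀ (r : ℝ) (x : F), W (r • x) = r • W x := by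
      intro r x
      rw [RCLike.real_smul_eq_coe_smul (K := ℂ), map_smul, ← RCLike.real_smul_eq_coe_smul (K := ℂ)]
    rw [hv, hv', map_sub, hr, hr, h.map_vec, resolventDiff, smul_sub]
    abel
  simp only [e1, map_specApply]
  simp only [specApply]
  rw [intervalIntegral.integral_sub, intervalIntegral.integral_finsetSum,
    intervalIntegral.integral_finsetSum]
  · simp only [intervalIntegral.integral_smul_const]
  · exact fun j _ => hk _ (h.nonneg' j) _
  · exact fun i _ => hk _ (h.nonneg i) _
  · exact (continuousOn_finsetSum _ fun i _ =>
      ((continuousOn_sqrtKernel (h.nonneg i)).mono hsub).smul continuousOn_const).intervalIntegrable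
  · exact (continuousOn_finsetSum _ fun j _ =>
      ((continuousOn_sqrtKernel (h.nonneg' j)).mono hsub).smul continuousOn_const).intervalIntegrable

theorem Compression.norm_truncated_le (h : Compression e l e' l' W v v') {T : ℝ} (hT : 1 ≤ T) :
    ‖specApply e l (fun x => ∫ t in T⁻¹..T, sqrtKernel t x) v -
        W (specApply e' l' (fun x => ∫ t in T⁻¹..T, sqrtKernel t x) v')‖ ^ 2 ≤
      T * ∫ t in T⁻¹..T, t * ‖resolventDiff e l e' l' W v v' t‖ ^ 2 := by
  have hT0 : 0 < T := by linarith
  have hi : 0 < T⁻¹ := by positivity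
  have hle : T⁻¹ ≤ T := (inv_le_one_of_one_le₀ hT).trans hT
  have hsub : Icc T⁻¹ T ⊆ Ioi 0 := fun t ht => lt_of_lt_of_le hi ht.1
  rw [h.truncated_eq hi hle]
  have h1 := intervalIntegral.norm_integral_le_integral_norm (μ := volume)
    (f := fun t => Real.sqrt t • resolventDiff e l e' l' W v v' t) hle
  have hc : ContinuousOn (fun t => ‖Real.sqrt t • resolventDiff e l e' l' W v v' t‖)
      (Icc T⁻¹ T) :=
    (Real.continuous_sqrt.continuousOn.smul (h.continuousOn_resolventDiff.mono hsub)).norm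
  have h2 := sq_intervalIntegral_le hle hc
  have h3 : ∫ t in T⁻¹..T, ‖Real.sqrt t • resolventDiff e l e' l' W v v' t‖ ^ 2 =
      ∫ t in T⁻¹..T, t * ‖resolventDiff e l e' l' W v v' t‖ ^ 2 := by
    refine intervalIntegral.integral_congr fun t ht => ?_
    rw [uIcc_of_le hle] at ht
    have : (0 : ℝ) < t := hsub ht
    simp [norm_smul, mul_pow, sq_abs, Real.sq_sqrt this.le]
  rw [h3] at h2
  have h4 : 0 ≤ ∫ t in T⁻¹..T, t * ‖resolventDiff e l e' l' W v v' t‖ ^ 2 := by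
    refine intervalIntegral.integral_nonneg hle fun t ht => ?_
    have : (0 : ℝ) < t := hsub ht
    positivity
  calc _ ≤ _ := pow_le_pow_left₀ (norm_nonneg _) h1 2
    _ ≤ _ := h2
    -- The interval length `T - T⁻¹` is at most `T`.
    _ ≤ _ := mul_le_mul_of_nonneg_right (by linarith) h4

theorem norm_specApply_one_add_le {I E : Type*} [Fintype I] [NormedAddCommGroup E]
    [InnerProductSpace ℂ E] (e : OrthonormalBasis I ℂ E) (l : I → ℝ) {r : ℝ} (hr : 0 ≤ r)
    {g : ℝ → ℝ} (v : E) (H : ∀ i, |g (l i)| ≤ r * (1 + l i)) :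
    ‖specApply e l g v‖ ≤ r * (‖v‖ + ‖specApply e l id v‖) := by
  refine (norm_specApply_le e l (h := fun x => r * (1 + x)) v H).trans ?_
  rw [specApply_const_mul, norm_smul, Real.norm_of_nonneg hr]
  refine mul_le_mul_of_nonneg_left ?_ hr
  have := specApply_add e l (fun _ => 1) id v
  rw [specApply_one] at this
  simp only [id] at this
  rw [this]
  exact norm_add_le _ _

/-- Bound on the defect of the square roots in terms of a cut-off `T`. -/
theorem Compression.norm_sqrt_diff_le (h : Compression e l e' l' W v v') {L : ℝ → ℝ}
    (hL : ∀ T, 1 ≤ T →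
      ∫ t in T⁻¹..T, t * ‖resolventDiff e l e' l' W v v' t‖ ^ 2 ≤ L T)
    {T : ℝ} (hT : 0 < T) :
    Real.pi * ‖specApply e l Real.sqrt v - W (specApply e' l' Real.sqrt v')‖ ≤
      2 * (‖v‖ + ‖specApply e l id v‖ + ‖v'‖ + ‖specApply e' l' id v'‖) / Real.sqrt T +
        Real.sqrt (T * L T) := by
  have hr : 0 ≤ 2 / Real.sqrt T := by positivity
  have hW : ∀ (r : ℝ) (x : F), W (r • x) = r • W x := by
    intro r x
    rw [RCLike.real_smul_eq_coe_smul (K := ℂ), map_smul, ← RCLike.real_smul_eq_coe_smul (K := ℂ)]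
  have h0 : Real.pi * ‖specApply e l Real.sqrt v - W (specApply e' l' Real.sqrt v')‖ =
      ‖specApply e l (fun x => Real.pi * Real.sqrt x) v -
        W (specApply e' l' (fun x => Real.pi * Real.sqrt x) v')‖ := by
    rw [specApply_const_mul, specApply_const_mul, hW, ← smul_sub, norm_smul,
      Real.norm_of_nonneg Real.pi_pos.le]
  rw [h0]
  -- Here `k` approximates `π √x` on the spectra: the truncated integral when `T ≥ 1`, zero when `T
  -- ≤ 1`.
  suffices H : ∃ k : ℝ → ℝ,
      (∀ x, 0 ≤ x → |Real.pi * Real.sqrt x - k x| ≤ 2 / Real.sqrt T * (1 + x)) ∧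
      ‖specApply e l k v - W (specApply e' l' k v')‖ ≤ Real.sqrt (T * L T) by
    obtain ⟨k, hk1, hk2⟩ := H
    have b1 := norm_specApply_one_add_le e l hr (g := fun x => Real.pi * Real.sqrt x - k x) v
      fun i => hk1 _ (h.nonneg i)
    have b2 := norm_specApply_one_add_le e' l' hr (g := fun x => Real.pi * Real.sqrt x - k x) v'
      fun i => hk1 _ (h.nonneg' i)
    have b3 := (h.contraction _).trans b2
    rw [specApply_sub] at b1 b3
    rw [map_sub] at b3
    have : specApply e l (fun x => Real.pi * Real.sqrt x) v -
        W (specApply e' l' (fun x => Real.pi * Real.sqrt x) v') =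
        (specApply e l (fun x => Real.pi * Real.sqrt x) v - specApply e l k v) -
        (W (specApply e' l' (fun x => Real.pi * Real.sqrt x) v') - W (specApply e' l' k v')) +
        (specApply e l k v - W (specApply e' l' k v')) := by abel
    rw [this]
    refine (norm_add_le _ _).trans (add_le_add ((norm_sub_le _ _).trans ?_) hk2)
    refine (add_le_add b1 b3).trans (le_of_eq ?_)
    ring
  rcases le_total 1 T with h1 | h1
  · refine ⟨_, fun x hx => abs_pi_sqrt_sub_le hx h1, ?_⟩
    refine Real.le_sqrt_of_sq_le ((h.norm_truncated_le h1).trans ?_)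
    exact mul_le_mul_of_nonneg_left (hL T h1) hT.le
  · refine ⟨fun _ => 0, fun x hx => by simpa using abs_pi_sqrt_le hx hT h1, ?_⟩
    simp [specApply, Real.sqrt_nonneg]

end Truncation

/-! ### The canonical representation, including the value at zero -/

section Representation

/-- The integrand of the canonical representation. -/
noncomputable def repKernel (t x : ℝ) : ℝ := 1 / (t + x) - t / (t ^ 2 + 1)

/-- `g x` is given by the canonical integral representation, with an integrable integrand. -/
def RepAt (g : ℝ → ℝ) (a b : ℝ) (μ : Measure ℝ) (x : ℝ) : Prop :=
  Integrable (fun t => repKernel t x) μ ∧ g x = a * x + b + ∫ t, repKernel t x ∂μ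

theorem measurable_repKernel (x : ℝ) : Measurable fun t => repKernel t x := by
  unfold repKernel
  fun_prop

theorem ae_pos_of_absolutelyContinuous {μ : Measure ℝ} (hμ : μ ≪ volume) (h0 : μ (Iio 0) = 0) :
    ∀ᵐ t ∂μ, 0 < t := by
  rw [ae_iff]
  have : {t : ℝ | ¬ 0 < t} = Iio 0 ∪ {0} := by
    ext t; simp [le_iff_lt_or_eq]
  rw [this]
  exact measure_union_null h0 (hμ (by simp))

variable {f : ℝ → ℝ} {a b : ℝ} {μ : Measure ℝ}

theorem IsCanonicalRep.integrable_repKernel (h : IsCanonicalRep f a b μ) (hpos : ∀ᵐ t ∂μ, 0 < t)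
    {x : ℝ} (hx : 0 < x) : Integrable (fun t => repKernel t x) μ := by
  refine (h.integrable.const_mul (1 / x + x)).mono' (measurable_repKernel x).aestronglyMeasurable ?_
  filter_upwards [hpos] with t ht
  -- The first factor is bounded uniformly in `t > 0` by `1/x + x`; the second is integrable by
  -- assumption.
  have h1 : repKernel t x = (1 - t * x) / (t + x) * (1 / (t ^ 2 + 1)) := by
    unfold repKernel; field_simp; ring
  rw [h1, norm_mul, Real.norm_of_nonneg (by positivity : 0 ≤ 1 / (t ^ 2 + 1))]
  refine mul_le_mul_of_nonneg_right ?_ (by positivity)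
  have htx : 0 < t * x := by positivity
  rw [norm_div, Real.norm_of_nonneg (by positivity : 0 ≤ t + x), div_le_iff₀ (by positivity),
    Real.norm_eq_abs]
  have h2 : (1 / x + x) * (t + x) = 1 + t * x + t / x + x ^ 2 := by field_simp; ring
  have h3 : 0 < t / x := by positivity
  rw [h2, abs_le]
  constructor <;> nlinarith [sq_nonneg x]

theorem repKernel_anti {t x y : ℝ} (ht : 0 < t) (hx : 0 ≤ x) (hxy : x ≤ y) :
    repKernel t y ≤ repKernel t x := by
  unfold repKernel
  have : 1 / (t + y) ≤ 1 / (t + x) := one_div_le_one_div_of_le (by linarith) (by linarith)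
  linarith

theorem IsCanonicalRep.antitoneOn (h : IsCanonicalRep f a b μ) (hpos : ∀ᵐ t ∂μ, 0 < t) :
    AntitoneOn f (Ioi 0) := by
  intro x hx y hy hxy
  rw [h.eq_integral x hx, h.eq_integral y hy]
  have h1 : a * y ≤ a * x := mul_le_mul_of_nonpos_left hxy h.slope_nonpos
  have h2 : ∫ t, repKernel t y ∂μ ≤ ∫ t, repKernel t x ∂μ := by
    refine integral_mono_ae (h.integrable_repKernel hpos hy) (h.integrable_repKernel hpos hx) ?_
    filter_upwards [hpos] with t ht
    exact repKernel_anti ht (le_of_lt hx) hxy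
  unfold repKernel at h2
  linarith

theorem IsCanonicalRep.repAt_extZero_of_pos (h : IsCanonicalRep f a b μ)
    (hpos : ∀ᵐ t ∂μ, 0 < t) {x : ℝ} (hx : 0 < x) : RepAt (extZero f) a b μ x := by
  refine ⟨h.integrable_repKernel hpos hx, ?_⟩
  rw [extZero, Function.update_of_ne hx.ne']
  exact h.eq_integral x hx

/-- Monotone convergence along `x_n = 1/(n+1)`: as `x` decreases the kernels increase, and an upper
bound for `f` bounds their integrals, so the kernel at `0` is integrable. Antitonicity of `f`
identifies the limit with the supremum. -/
theorem IsCanonicalRep.repAt_extZero_zero (h : IsCanonicalRep f a b μ)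
    (hpos : ∀ᵐ t ∂μ, 0 < t) (hb : BddAbove (f '' Ioi 0)) : RepAt (extZero f) a b μ 0 := by
  set s : ℝ := sSup (f '' Ioi 0) with hs
  set x : ℕ → ℝ := fun n => 1 / ((n : ℝ) + 1) with hx
  have hx0 : ∀ n, 0 < x n := fun n => by simp only [hx]; positivity
  have hxanti : Antitone x := fun i j hij => by
    simp only [hx]
    exact one_div_le_one_div_of_le (by positivity) (by exact_mod_cast Nat.succ_le_succ hij)
  have hxlim : Filter.Tendsto x Filter.atTop (nhds 0) := tendsto_one_div_add_atTop_nhds_zero_nat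
  have hfs : ∀ n, f (x n) ≤ s := fun n => le_csSup hb ⟨x n, hx0 n, rfl⟩
  have hint : ∀ n, Integrable (fun t => repKernel t (x n)) μ := fun n =>
    h.integrable_repKernel hpos (hx0 n)
  have hmono : ∀ᵐ t ∂μ, Monotone fun n => repKernel t (x n) := by
    filter_upwards [hpos] with t ht
    exact fun i j hij => repKernel_anti ht (hx0 j).le (hxanti hij)
  have hlim : ∀ᵐ t ∂μ, Filter.Tendsto (fun n => repKernel t (x n)) Filter.atTop
      (nhds (repKernel t 0)) := by
    filter_upwards [hpos] with t ht
    unfold repKernel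
    refine Filter.Tendsto.sub_const ?_ _
    refine Filter.Tendsto.div tendsto_const_nhds (hxlim.const_add t) ?_
    simpa using ht.ne'
  have hI : ∀ n, ∫ t, repKernel t (x n) ∂μ = f (x n) - a * x n - b := fun n => by
    rw [h.eq_integral _ (hx0 n)]; unfold repKernel; ring
  have hbound : ∀ n, ∫ t, (repKernel t (x n) - repKernel t (x 0)) ∂μ ≤
      s - a - b - ∫ t, repKernel t (x 0) ∂μ := fun n => by
    rw [integral_sub (hint n) (hint 0), hI n]
    have h1 : x n ≤ 1 := by simpa [hx] using hxanti (Nat.zero_le n)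
    have := mul_le_mul_of_nonpos_left h1 h.slope_nonpos
    linarith [hfs n]
  have hint0 : Integrable (fun t => repKernel t 0 - repKernel t (x 0)) μ := by
    refine ⟨((measurable_repKernel 0).sub (measurable_repKernel _)).aestronglyMeasurable, ?_⟩
    rw [hasFiniteIntegral_iff_ofReal]
    · have ht := lintegral_tendsto_of_tendsto_of_monotone (μ := μ)
        (f := fun n t => ENNReal.ofReal (repKernel t (x n) - repKernel t (x 0)))
        (F := fun t => ENNReal.ofReal (repKernel t 0 - repKernel t (x 0)))
        (fun n => ((measurable_repKernel _).sub
          (measurable_repKernel _)).ennreal_ofReal.aemeasurable)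
        (by
          filter_upwards [hmono] with t ht i j hij
          exact ENNReal.ofReal_le_ofReal (sub_le_sub_right (ht hij) _))
        (by
          filter_upwards [hlim] with t ht
          exact (ENNReal.continuous_ofReal.tendsto _).comp (ht.sub_const _))
      refine (le_of_tendsto' ht (b := ENNReal.ofReal
        (s - a - b - ∫ t, repKernel t (x 0) ∂μ)) fun n => ?_).trans_lt ENNReal.ofReal_lt_top
      rw [← ofReal_integral_eq_lintegral_ofReal
        (f := fun t => repKernel t (x n) - repKernel t (x 0)) ((hint n).sub (hint 0))]
      · exact ENNReal.ofReal_le_ofReal (hbound n)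
      · filter_upwards [hmono] with t ht
        exact sub_nonneg.mpr (ht (Nat.zero_le n))
    · filter_upwards [hpos] with t ht
      exact sub_nonneg.mpr (repKernel_anti ht le_rfl (hx0 0).le)
  have hintk : Integrable (fun t => repKernel t 0) μ :=
    (hint0.add (hint 0)).congr (Filter.Eventually.of_forall fun t => by simp)
  refine ⟨hintk, ?_⟩
  have hconv := integral_tendsto_of_tendsto_of_monotone hint hintk hmono hlim
  have hconvf : Filter.Tendsto (fun n => f (x n)) Filter.atTop
      (nhds (a * 0 + b + ∫ t, repKernel t 0 ∂μ)) := by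
    have : ∀ n, f (x n) = a * x n + b + ∫ t, repKernel t (x n) ∂μ := fun n => by
      rw [hI n]; ring
    simp only [this]
    exact ((hxlim.const_mul a).add_const b).add hconv
  rw [extZero, Function.update_self]
  refine le_antisymm ?_ (le_of_tendsto' hconvf hfs)
  refine csSup_le ⟨_, 1, by simp, rfl⟩ ?_
  rintro _ ⟨y, hy, rfl⟩
  refine ge_of_tendsto hconvf ?_
  filter_upwards [hxlim.eventually (gt_mem_nhds hy)] with n hn
  exact h.antitoneOn hpos (hx0 n) hy (le_of_lt hn)

/-- Without a representation `repMeasure f` defaults to zero, which cannot dominate Lebesgue measure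
on `[1, 2]`. Löwner's theorem is thus not needed. -/
theorem IsRegular.exists_canonicalRep (hf : IsRegular f) :
    ∃ a b, IsCanonicalRep f a b (repMeasure f) := by
  by_cases h : ∃ μ : Measure ℝ, ∃ a b : ℝ, IsCanonicalRep f a b μ
  · have := h.choose_spec
    rwa [repMeasure, dif_pos h]
  · exfalso
    have h0 : repMeasure f = 0 := by rw [repMeasure, dif_neg h]
    obtain ⟨C, hC⟩ := hf.lower_bound 1 2 one_pos two_pos
    have := hC (Icc (1 / 1) 2)
    rw [h0] at this
    norm_num at this

theorem regConst_half (T : ℝ) : regConst f T (1 / 2) =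
    sInf {C : ℝ≥0∞ | (volume : Measure ℝ).restrict (Icc T⁻¹ T) ≤
      C • (repMeasure f).restrict (Icc T⁻¹ T)} := by
  have h1 : cutL T (1 / 2) = T := by simp [cutL]
  have h2 : cutR T (1 / 2) = T := by rw [cutR, if_pos le_rfl]; norm_num
  rw [regConst, h1, h2]

end Representation

/-! ### The entropy difference as an integral of resolvent defects -/

section Defect

variable {I J E F : Type*} [Fintype I] [Fintype J] [NormedAddCommGroup E] [InnerProductSpace ℂ E]
  [NormedAddCommGroup F] [InnerProductSpace ℂ F]
  {a b : ℝ} {μ : Measure ℝ} {g : ℝ → ℝ}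

/-- The representation is required only at eigenvalues where `v` has a component, which leaves room
for `f(0+) = ∞`. -/
theorem specForm_eq_integral (e : OrthonormalBasis I ℂ E) (l : I → ℝ) (v : E)
    (hrep : ∀ i, inner ℂ (e i) v ≠ 0 → RepAt g a b μ (l i)) :
    Integrable (fun t => specForm e l (repKernel t) v) μ ∧
      specForm e l g v = a * specForm e l id v + b * ‖v‖ ^ 2 +
        ∫ t, specForm e l (repKernel t) v ∂μ := by
  have hi : ∀ i, Integrable (fun t => repKernel t (l i) * ‖inner ℂ (e i) v‖ ^ 2) μ := by
    intro i
    by_cases h : inner ℂ (e i) v = 0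
    · simp [h]
    · exact (hrep i h).1.mul_const _
  refine ⟨integrable_finsetSum _ fun i _ => hi i, ?_⟩
  unfold specForm
  rw [integral_finsetSum _ fun i _ => hi i, ← e.sum_sq_norm_inner_right v, Finset.mul_sum,
    Finset.mul_sum, ← Finset.sum_add_distrib, ← Finset.sum_add_distrib]
  refine Finset.sum_congr rfl fun i _ => ?_
  by_cases h : inner ℂ (e i) v = 0
  · simp [h]
  · rw [(hrep i h).2, integral_mul_const]
    simp only [id]
    ring

variable {e : OrthonormalBasis I ℂ E} {l : I → ℝ} {e' : OrthonormalBasis J ℂ F} {l' : J → ℝ}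
  {W : F →ₗ[ℂ] E} {v : E} {v' : F}

/-- The slope terms cancel by `hid`; the constant `b` and the counterterm `t / (t² + 1)` cancel
because `‖v‖ = ‖v'‖`. -/
theorem Compression.specForm_sub_eq_integral (h : Compression e l e' l' W v v')
    (hrep : ∀ i, inner ℂ (e i) v ≠ 0 → RepAt g a b μ (l i))
    (hrep' : ∀ j, inner ℂ (e' j) v' ≠ 0 → RepAt g a b μ (l' j))
    (hid : specForm e l id v = specForm e' l' id v') :
    Integrable (fun t => specForm e l (fun y => 1 / (t + y)) v -
      specForm e' l' (fun y => 1 / (t + y)) v') μ ∧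
    specForm e l g v - specForm e' l' g v' =
      ∫ t, (specForm e l (fun y => 1 / (t + y)) v -
        specForm e' l' (fun y => 1 / (t + y)) v') ∂μ := by
  obtain ⟨h1, h2⟩ := specForm_eq_integral e l v hrep
  obtain ⟨h3, h4⟩ := specForm_eq_integral e' l' v' hrep'
  have key : ∀ t, specForm e l (fun y => 1 / (t + y)) v -
      specForm e' l' (fun y => 1 / (t + y)) v' =
      specForm e l (repKernel t) v - specForm e' l' (repKernel t) v' := by
    intro t
    have h5 := norm_sq_eq_specForm e l v
    have h6 := norm_sq_eq_specForm e' l' v'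
    rw [h.norm_eq, h6] at h5
    simp only [specForm, repKernel, sub_mul, Finset.sum_sub_distrib, ← Finset.mul_sum, one_mul]
      at h5 ⊢
    rw [h5]
    ring
  simp only [key]
  refine ⟨h1.sub h3, ?_⟩
  rw [integral_sub h1 h3, h2, h4, hid, h.norm_eq]
  ring

theorem Compression.defect_nonneg (h : Compression e l e' l' W v v') (hpos : ∀ᵐ t ∂μ, 0 < t)
    (hrep : ∀ i, inner ℂ (e i) v ≠ 0 → RepAt g a b μ (l i))
    (hrep' : ∀ j, inner ℂ (e' j) v' ≠ 0 → RepAt g a b μ (l' j))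
    (hid : specForm e l id v = specForm e' l' id v') :
    0 ≤ specForm e l g v - specForm e' l' g v' := by
  rw [(h.specForm_sub_eq_integral hrep hrep' hid).2]
  refine integral_nonneg_of_ae ?_
  filter_upwards [hpos] with t ht
  exact le_trans (by positivity) (h.resolvent_bound ht)

/-- Regularity exchanges Lebesgue measure on `[1/T, T]` for `μ`. Since the defect is nonnegative
`μ`-a.e., enlarging the domain to the half-line gives the full entropy difference. -/
theorem Compression.integral_resolventDiff_le (h : Compression e l e' l' W v v')
    (hpos : ∀ᵐ t ∂μ, 0 < t)
    (hrep : ∀ i, inner ℂ (e i) v ≠ 0 → RepAt g a b μ (l i))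
    (hrep' : ∀ j, inner ℂ (e' j) v' ≠ 0 → RepAt g a b μ (l' j))
    (hid : specForm e l id v = specForm e' l' id v') {T K : ℝ} (hT : 1 ≤ T) (hK : 0 ≤ K)
    (hreg : sInf {C : ℝ≥0∞ | (volume : Measure ℝ).restrict (Icc T⁻¹ T) ≤
      C • μ.restrict (Icc T⁻¹ T)} ≤ ENNReal.ofReal K) :
    ∫ t in T⁻¹..T, t * ‖resolventDiff e l e' l' W v v' t‖ ^ 2 ≤
      K * (specForm e l g v - specForm e' l' g v') := by
  have hT0 : 0 < T := by linarith
  have hi : 0 < T⁻¹ := by positivity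
  have hle : T⁻¹ ≤ T := (inv_le_one_of_one_le₀ hT).trans hT
  have hsub : Icc T⁻¹ T ⊆ Ioi 0 := fun t ht => lt_of_lt_of_le hi ht.1
  have hD0 := h.defect_nonneg hpos hrep hrep' hid
  obtain ⟨hint, hD⟩ := h.specForm_sub_eq_integral hrep hrep' hid
  set D := specForm e l g v - specForm e' l' g v' with hDdef
  set d : ℝ → ℝ := fun t => specForm e l (fun y => 1 / (t + y)) v -
    specForm e' l' (fun y => 1 / (t + y)) v' with hd
  have hdm : Measurable fun t => ENNReal.ofReal (d t) := by
    simp only [hd, specForm]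
    fun_prop
  have hcont : ContinuousOn (fun t => t * ‖resolventDiff e l e' l' W v v' t‖ ^ 2)
      (Icc T⁻¹ T) :=
    continuousOn_id.mul ((h.continuousOn_resolventDiff.mono hsub).norm.pow 2)
  have hDint : ∫⁻ t, ENNReal.ofReal (d t) ∂μ = ENNReal.ofReal D := by
    rw [hD, ofReal_integral_eq_lintegral_ofReal hint]
    filter_upwards [hpos] with t ht
    exact le_trans (by positivity) (h.resolvent_bound ht)
  set N := ∫⁻ t in Icc T⁻¹ T, ENNReal.ofReal (d t) with hN
  have hNC : ∀ C ∈ {C : ℝ≥0∞ | (volume : Measure ℝ).restrict (Icc T⁻¹ T) ≤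
      C • μ.restrict (Icc T⁻¹ T)}, N ≤ C * ENNReal.ofReal D := by
    intro C hC
    calc N ≤ ∫⁻ t, ENNReal.ofReal (d t) ∂(C • μ.restrict (Icc T⁻¹ T)) := lintegral_mono' hC le_rfl
      _ = C * ∫⁻ t in Icc T⁻¹ T, ENNReal.ofReal (d t) ∂μ := by rw [lintegral_smul_measure]; rfl
      _ ≤ C * ∫⁻ t, ENNReal.ofReal (d t) ∂μ := by
          gcongr; exact Measure.restrict_le_self
      _ = _ := by rw [hDint]
  have hNK : N ≤ ENNReal.ofReal K * ENNReal.ofReal D := by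
    -- For `D > 0`, `N / D` is a lower bound for the admissible constants, so it lies below their
    -- infimum. For `D = 0` any admissible constant will do; one exists because the infimum of the
    -- empty set is `∞`.
    rcases hD0.eq_or_lt with h0 | h0
    · have hne : {C : ℝ≥0∞ | (volume : Measure ℝ).restrict (Icc T⁻¹ T) ≤
          C • μ.restrict (Icc T⁻¹ T)}.Nonempty := by
        by_contra hcon
        rw [not_nonempty_iff_eq_empty] at hcon
        rw [hcon, sInf_empty] at hreg
        exact ENNReal.ofReal_ne_top (top_le_iff.mp hreg)
      obtain ⟨C, hC⟩ := hne
      have := hNC C hC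
      rw [← h0] at this ⊢
      simpa using this
    · have h1 : ENNReal.ofReal D ≠ 0 := by simpa using h0
      rw [← ENNReal.div_le_iff h1 ENNReal.ofReal_ne_top]
      refine le_trans (le_sInf fun C hC => ?_) hreg
      rw [ENNReal.div_le_iff h1 ENNReal.ofReal_ne_top]
      exact hNC C hC
  rw [intervalIntegral.integral_of_le hle, ← integral_Icc_eq_integral_Ioc]
  rw [integral_eq_lintegral_of_nonneg_ae]
  · refine ENNReal.toReal_le_of_le_ofReal (by positivity) ?_
    rw [ENNReal.ofReal_mul hK]
    refine le_trans (setLIntegral_mono hdm fun t ht => ?_) hNK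
    exact ENNReal.ofReal_le_ofReal (h.resolvent_bound (hsub ht))
  · filter_upwards [ae_restrict_mem measurableSet_Icc] with t ht
    have : (0 : ℝ) < t := hsub ht
    simp only [Pi.zero_apply]
    positivity
  · exact hcont.aestronglyMeasurable measurableSet_Icc

/-- Stability of the square root under a small entropy defect. -/
theorem Compression.norm_sqrt_diff_le_defect [CompleteSpace E] (h : Compression e l e' l' W v v')
    (hpos : ∀ᵐ t ∂μ, 0 < t)
    (hrep : ∀ i, inner ℂ (e i) v ≠ 0 → RepAt g a b μ (l i))
    (hrep' : ∀ j, inner ℂ (e' j) v' ≠ 0 → RepAt g a b μ (l' j))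
    (hid : specForm e l id v = specForm e' l' id v') {C c A : ℝ} (hC : 0 < C) (hc : 0 < c)
    (hreg : ∀ T : ℝ, 0 < T → sInf {C : ℝ≥0∞ | (volume : Measure ℝ).restrict (Icc T⁻¹ T) ≤
      C • μ.restrict (Icc T⁻¹ T)} ≤ ENNReal.ofReal (C * T ^ (2 * c)))
    (hA : 2 * (‖v‖ + ‖specApply e l id v‖ + ‖v'‖ + ‖specApply e' l' id v'‖) ≤ A) :
    Real.pi * ‖specApply e l Real.sqrt v - W (specApply e' l' Real.sqrt v')‖ ≤
      2 * A ^ ((1 + 2 * c) / (2 * (1 + c))) * (C ^ (1 / (4 * (1 + c))) *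
        (specForm e l g v - specForm e' l' g v') ^ (1 / (4 * (1 + c)))) := by
  have hD0 := h.defect_nonneg hpos hrep hrep' hid
  set D := specForm e l g v - specForm e' l' g v' with hDdef
  have hA0 : 0 ≤ A := le_trans (by positivity) hA
  have hCD : 0 ≤ C * D := by positivity
  -- The cut-off lemma is applied with `B = √(C D)`; this square root turns its exponent
  -- `1/(2(1+c))` into `1/(4(1+c))`.
  have e1 : C ^ (1 / (4 * (1 + c))) * D ^ (1 / (4 * (1 + c))) =
      (Real.sqrt (C * D)) ^ (1 / (2 * (1 + c))) := by
    rw [← Real.mul_rpow hC.le hD0, Real.sqrt_eq_rpow, ← Real.rpow_mul hCD]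
    congr 1
    field_simp
    norm_num
  rw [e1]
  refine le_of_forall_cutoff hA0 (Real.sqrt_nonneg _) hc fun T hT => ?_
  have h1 := h.norm_sqrt_diff_le (L := fun T => (C * T ^ (2 * c)) * D) (fun T hT1 => by
    have hT' : 0 < T := by linarith
    exact h.integral_resolventDiff_le hpos hrep hrep' hid hT1 (by positivity) (hreg T hT')) hT
  refine h1.trans (add_le_add (by gcongr) (le_of_eq ?_))
  have e2 : T * (C * T ^ (2 * c) * D) = (C * D) * (T ^ (1 / 2 + c)) ^ 2 := by
    have : (T ^ (1 / 2 + c)) ^ 2 = T * T ^ (2 * c) := by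
      rw [← Real.rpow_natCast, ← Real.rpow_mul hT.le]
      conv_rhs => rw [← Real.rpow_one_add' hT.le (by positivity)]
      congr 1
      push_cast
      ring
    rw [this]; ring
  rw [e2, Real.sqrt_mul hCD, Real.sqrt_sq (by positivity)]

end Defect

/-! ### Matrices as vectors of Hilbert-Schmidt space -/

section HilbertSchmidt

variable {ι : Type*} [Fintype ι] [DecidableEq ι]

/-- A matrix as a vector of the Hilbert-Schmidt space. -/
noncomputable def hs : Matrix ι ι ℂ ≃ₗ[ℂ] EuclideanSpace ℂ (ι × ι) where
  toFun X := WithLp.toLp 2 fun p => X p.1 p.2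
  map_add' _ _ := rfl
  map_smul' _ _ := rfl
  invFun x := Matrix.of fun i j => x (i, j)
  left_inv _ := rfl
  right_inv _ := rfl

@[simp] theorem hs_apply (X : Matrix ι ι ℂ) (p : ι × ι) : hs X p = X p.1 p.2 := rfl

theorem inner_hs (X Y : Matrix ι ι ℂ) : inner ℂ (hs X) (hs Y) = (Xᴴ * Y).trace := by
  simp only [PiLp.inner_apply, hs_apply, Fintype.sum_prod_type, Matrix.trace, Matrix.diag,
    Matrix.mul_apply, Matrix.conjTranspose_apply]
  rw [Finset.sum_comm]
  refine Finset.sum_congr rfl fun i _ => Finset.sum_congr rfl fun j _ => ?_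
  simp [mul_comm]

theorem norm_hs_sq (X : Matrix ι ι ℂ) : ‖hs X‖ ^ 2 = (Xᴴ * X).trace.re := by
  rw [← inner_hs, inner_self_eq_norm_sq_to_K]
  norm_cast

theorem norm_hs_conjTranspose (X : Matrix ι ι ℂ) : ‖hs Xᴴ‖ = ‖hs X‖ := by
  rw [← sq_eq_sq₀ (norm_nonneg _) (norm_nonneg _), norm_hs_sq, norm_hs_sq,
    conjTranspose_conjTranspose, trace_mul_comm]

theorem hs_eq_zero_of_trace {X : Matrix ι ι ℂ} (h : (Xᴴ * X).trace = 0) : X = 0 := by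
  simpa using trace_conjTranspose_mul_self_eq_zero_iff.mp h

theorem repr_stdBasis (X : Matrix ι ι ℂ) (p : ι × ι) :
    (Matrix.stdBasis ℂ ι ι).repr X p = X p.1 p.2 := by
  simp [Matrix.stdBasis]

theorem hs_toLin (N : Matrix (ι × ι) (ι × ι) ℂ) (X : Matrix ι ι ℂ) :
    hs (Matrix.toLin (Matrix.stdBasis ℂ ι ι) (Matrix.stdBasis ℂ ι ι) N X) =
      WithLp.toLp 2 (N *ᵥ (hs X).ofLp) := by
  ext p
  have h := congrFun (LinearMap.toMatrix_mulVec_repr (Matrix.stdBasis ℂ ι ι)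
    (Matrix.stdBasis ℂ ι ι) (Matrix.toLin (Matrix.stdBasis ℂ ι ι) (Matrix.stdBasis ℂ ι ι) N) X) p
  rw [LinearMap.toMatrix_toLin, repr_stdBasis] at h
  rw [hs_apply, ← h]
  congr 2

/-- In Kronecker form, positivity and the square root of the modular operator are inherited from the
two factors. -/
theorem toMatrix_mulLeft_mulRight (A B : Matrix ι ι ℂ) :
    LinearMap.toMatrix (Matrix.stdBasis ℂ ι ι) (Matrix.stdBasis ℂ ι ι)
      (LinearMap.mulLeft ℂ A ∘ₗ LinearMap.mulRight ℂ B) = A ⊗ₖ Bᵀ := by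
  ext ⟨i, j⟩ ⟨k, l⟩
  rw [LinearMap.toMatrix_apply, repr_stdBasis, stdBasis_eq_single]
  simp [Matrix.mul_apply, Matrix.single_apply, ite_and]

theorem kronecker_transpose_mulVec_hs (A B X : Matrix ι ι ℂ) :
    WithLp.toLp 2 ((A ⊗ₖ Bᵀ) *ᵥ (hs X).ofLp) = hs (A * X * B) := by
  rw [← hs_toLin, ← toMatrix_mulLeft_mulRight, Matrix.toLin_toMatrix]
  simp [mul_assoc]

theorem toLp_cfc_mulVec {κ : Type*} [Fintype κ] [DecidableEq κ] {N : Matrix κ κ ℂ}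
    (hN : N.IsHermitian) (g : ℝ → ℝ) (x : EuclideanSpace ℂ κ) :
    WithLp.toLp 2 (cfc g N *ᵥ x.ofLp) =
      specApply hN.eigenvectorBasis hN.eigenvalues g x := by
  ext k
  rw [hN.cfc_eq, IsHermitian.cfc, Unitary.conjStarAlgAut_apply, specApply]
  simp only [Matrix.star_eq_conjTranspose, ← mulVec_mulVec, WithLp.ofLp_sum, Finset.sum_apply,
    WithLp.ofLp_smul, Pi.smul_apply, PiLp.inner_apply]
  rw [Matrix.mulVec, dotProduct]
  refine Finset.sum_congr rfl fun i _ => ?_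
  rw [mulVec_diagonal, Matrix.mulVec, dotProduct]
  simp only [conjTranspose_apply, IsHermitian.eigenvectorUnitary_apply]
  simp only [Function.comp_apply, RCLike.inner_apply, smul_eq_mul, Complex.real_smul,
    Finset.sum_mul, Finset.mul_sum]
  refine Finset.sum_congr rfl fun j _ => ?_
  simp
  ring

end HilbertSchmidt

/-! ### Powers, generalized inverses and support projections -/

section FunctionalCalculus

variable {ι : Type*} [Fintype ι] [DecidableEq ι]

/-- The spectrum is finite, so the continuous calculus also covers discontinuous functions such as
the generalized inverse. -/
theorem continuousOn_spectrum (A : Matrix ι ι ℂ) (g : ℝ → ℝ) : ContinuousOn g (spectrum ℝ A) :=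
  A.finite_real_spectrum.continuousOn g

theorem cfc_mul_cfc (A : Matrix ι ι ℂ) (g h : ℝ → ℝ) :
    cfc g A * cfc h A = cfc (fun x => g x * h x) A :=
  (cfc_mul g h A (continuousOn_spectrum A g) (continuousOn_spectrum A h)).symm

theorem isHermitian_cfc (A : Matrix ι ι ℂ) (g : ℝ → ℝ) : (cfc g A).IsHermitian :=
  cfc_predicate g A

theorem spectrum_nonneg {A : Matrix ι ι ℂ} (hA : A.PosSemidef) {x : ℝ} (hx : x ∈ spectrum ℝ A) :
    0 ≤ x := by
  rw [hA.1.spectrum_real_eq_range_eigenvalues] at hx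
  obtain ⟨i, rfl⟩ := hx
  exact hA.eigenvalues_nonneg i

theorem posSemidef_cfc {A : Matrix ι ι ℂ} {g : ℝ → ℝ}
    (hg : ∀ x ∈ spectrum ℝ A, 0 ≤ g x) : (cfc g A).PosSemidef := by
  have h : cfc g A = cfc (fun x => Real.sqrt (g x)) A * cfc (fun x => Real.sqrt (g x)) A := by
    rw [cfc_mul_cfc]
    exact cfc_congr fun x hx => (Real.mul_self_sqrt (hg x hx)).symm
  rw [h]
  nth_rewrite 1 [← (isHermitian_cfc A fun x => Real.sqrt (g x)).eq]
  exact posSemidef_conjTranspose_mul_self _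

variable {A : Matrix ι ι ℂ}

theorem cfc_id_of_isHermitian (hA : A.IsHermitian) : cfc (fun x : ℝ => x) A = A :=
  cfc_id' ℝ A hA

/-- The projection onto the support. -/
noncomputable def supp (A : Matrix ι ι ℂ) : Matrix ι ι ℂ := cfc (fun x : ℝ => x * x⁻¹) A

theorem msqrt_isHermitian : (msqrt A).IsHermitian := isHermitian_cfc _ _
theorem ginvSqrt_isHermitian : (ginvSqrt A).IsHermitian := isHermitian_cfc _ _
theorem supp_isHermitian : (supp A).IsHermitian := isHermitian_cfc _ _

theorem supp_mul_supp : supp A * supp A = supp A := by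
  rw [supp, cfc_mul_cfc]
  refine cfc_congr fun x _ => ?_
  by_cases h : x = 0 <;> simp [h]

theorem msqrt_mul_msqrt (hA : A.PosSemidef) : msqrt A * msqrt A = A := by
  rw [msqrt, cfc_mul_cfc]
  conv_rhs => rw [← cfc_id_of_isHermitian hA.1]
  exact cfc_congr fun x hx => Real.mul_self_sqrt (spectrum_nonneg hA hx)

theorem msqrt_posSemidef : (msqrt A).PosSemidef := posSemidef_cfc fun x _ => Real.sqrt_nonneg x

theorem ginvSqrt_posSemidef : (ginvSqrt A).PosSemidef := posSemidef_cfc fun x _ => by positivity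

theorem ginv_posSemidef (hA : A.PosSemidef) : (ginv A).PosSemidef :=
  posSemidef_cfc fun x hx => by have := spectrum_nonneg hA hx; positivity

theorem ginvSqrt_mul_ginvSqrt (hA : A.PosSemidef) : ginvSqrt A * ginvSqrt A = ginv A := by
  rw [ginvSqrt, cfc_mul_cfc]
  refine cfc_congr fun x hx => ?_
  rw [← mul_inv, Real.mul_self_sqrt (spectrum_nonneg hA hx)]

theorem sqrt_mul_inv_sqrt {x : ℝ} (hx : 0 ≤ x) : Real.sqrt x * (Real.sqrt x)⁻¹ = x * x⁻¹ := by
  rcases hx.eq_or_lt with rfl | h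
  · simp
  · rw [mul_inv_cancel₀ (Real.sqrt_pos.mpr h).ne', mul_inv_cancel₀ h.ne']

theorem msqrt_mul_ginvSqrt (hA : A.PosSemidef) : msqrt A * ginvSqrt A = supp A := by
  rw [msqrt, ginvSqrt, cfc_mul_cfc]
  exact cfc_congr fun x hx => sqrt_mul_inv_sqrt (spectrum_nonneg hA hx)

theorem ginvSqrt_mul_msqrt (hA : A.PosSemidef) : ginvSqrt A * msqrt A = supp A := by
  rw [msqrt, ginvSqrt, cfc_mul_cfc]
  exact cfc_congr fun x hx => (mul_comm _ _).trans (sqrt_mul_inv_sqrt (spectrum_nonneg hA hx))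

theorem self_mul_ginv (hA : A.IsHermitian) : A * ginv A = supp A := by
  nth_rewrite 1 [← cfc_id_of_isHermitian hA]
  rw [ginv, cfc_mul_cfc]; rfl

theorem ginv_mul_self (hA : A.IsHermitian) : ginv A * A = supp A := by
  nth_rewrite 2 [← cfc_id_of_isHermitian hA]
  rw [ginv, cfc_mul_cfc]
  exact cfc_congr fun x _ => mul_comm _ _

theorem self_mul_supp (hA : A.IsHermitian) : A * supp A = A := by
  nth_rewrite 1 3 [← cfc_id_of_isHermitian hA]
  rw [supp, cfc_mul_cfc]
  refine cfc_congr fun x _ => ?_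
  by_cases h : x = 0 <;> simp [h]

theorem msqrt_mul_supp : msqrt A * supp A = msqrt A := by
  rw [supp, msqrt, cfc_mul_cfc]
  refine cfc_congr fun x _ => ?_
  by_cases h : x = 0 <;> simp [h]

theorem supp_mul_ginvSqrt : supp A * ginvSqrt A = ginvSqrt A := by
  rw [supp, ginvSqrt, cfc_mul_cfc]
  refine cfc_congr fun x _ => ?_
  by_cases h : x = 0 <;> simp [h]

theorem msqrt_mul_ginv (hA : A.PosSemidef) : msqrt A * ginv A = ginvSqrt A := by
  rw [← ginvSqrt_mul_ginvSqrt hA, ← mul_assoc, msqrt_mul_ginvSqrt hA, supp_mul_ginvSqrt]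

theorem self_mul_ginvSqrt (hA : A.PosSemidef) : A * ginvSqrt A = msqrt A := by
  nth_rewrite 1 [← msqrt_mul_msqrt hA]
  rw [mul_assoc, msqrt_mul_ginvSqrt hA, msqrt_mul_supp]

/-- The range of `1 - supp A` lies in the kernel of `A`. This turns kernel inclusions into algebraic
identities. -/
theorem eq_mul_supp_of_ker (hA : A.IsHermitian) {G : Matrix ι ι ℂ}
    (h : ∀ x : ι → ℂ, A *ᵥ x = 0 → G *ᵥ x = 0) : G * supp A = G := by
  have h1 : ∀ y, G *ᵥ ((1 - supp A) *ᵥ y) = 0 := fun y => h _ <| by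
    rw [mulVec_mulVec, mul_sub, mul_one, self_mul_supp hA, sub_self, zero_mulVec]
  have h2 : G * (1 - supp A) = 0 := by
    refine Matrix.ext_of_mulVec_single fun i => ?_
    rw [← mulVec_mulVec, h1, zero_mulVec]
  rw [mul_sub, mul_one, sub_eq_zero] at h2
  exact h2.symm

/-- Uniqueness of the positive square root, for the calculus `cfc`. -/
theorem cfc_sqrt_eq {M : Matrix ι ι ℂ} (hM : M.PosSemidef) : cfc Real.sqrt (M * M) = M := by
  have h1 : M * M = cfc (fun x : ℝ => x * x) M := by
    rw [← cfc_mul_cfc, cfc_id_of_isHermitian hM.1]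
  have h2 := cfc_comp' Real.sqrt (fun x : ℝ => x * x) M
    ((M.finite_real_spectrum.image _).continuousOn _) (continuousOn_spectrum M _) hM.1
  rw [h1]
  refine h2.symm.trans ?_
  conv_rhs => rw [← cfc_id_of_isHermitian hM.1]
  exact cfc_congr fun x hx => Real.sqrt_mul_self (spectrum_nonneg hM hx)

end FunctionalCalculus

/-! ### Spectral data of the relative modular operator -/

section Modular

variable {ι : Type*} [Fintype ι] [DecidableEq ι] {σ ρ : Matrix ι ι ℂ}

theorem modular_posSemidef (hσ : σ.PosSemidef) (hρ : ρ.PosSemidef) :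
    (σ ⊗ₖ (ginv ρ)ᵀ).PosSemidef :=
  hσ.kronecker (ginv_posSemidef hρ).transpose

/-- An orthonormal eigenbasis of the relative modular operator. -/
noncomputable def modBasis (hσ : σ.PosSemidef) (hρ : ρ.PosSemidef) :
    OrthonormalBasis (ι × ι) ℂ (EuclideanSpace ℂ (ι × ι)) :=
  (modular_posSemidef hσ hρ).1.eigenvectorBasis

/-- The eigenvalues of the relative modular operator. -/
noncomputable def modEigen (hσ : σ.PosSemidef) (hρ : ρ.PosSemidef) : ι × ι → ℝ :=
  (modular_posSemidef hσ hρ).1.eigenvalues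

variable (hσ : σ.PosSemidef) (hρ : ρ.PosSemidef)

theorem modEigen_nonneg (i : ι × ι) : 0 ≤ modEigen hσ hρ i :=
  (modular_posSemidef hσ hρ).eigenvalues_nonneg i

theorem hs_superCfc (g : ℝ → ℝ) (X : Matrix ι ι ℂ) :
    hs (superCfc g (modularOp σ ρ) X) = specApply (modBasis hσ hρ) (modEigen hσ hρ) g (hs X) := by
  rw [superCfc, modularOp, toMatrix_mulLeft_mulRight, hs_toLin, toLp_cfc_mulVec]
  rfl

theorem specForm_hs (g : ℝ → ℝ) (X : Matrix ι ι ℂ) :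
    specForm (modBasis hσ hρ) (modEigen hσ hρ) g (hs X) =
      (Xᴴ * superCfc g (modularOp σ ρ) X).trace.re := by
  rw [← re_inner_specApply, ← inner_hs, hs_superCfc hσ hρ, ← inner_conj_symm, Complex.conj_re]

theorem specApply_id_hs (X : Matrix ι ι ℂ) :
    specApply (modBasis hσ hρ) (modEigen hσ hρ) id (hs X) = hs (σ * X * ginv ρ) := by
  rw [← kronecker_transpose_mulVec_hs, modBasis, modEigen, ← toLp_cfc_mulVec]
  have := cfc_id_of_isHermitian (modular_posSemidef hσ hρ).1
  rw [show (id : ℝ → ℝ) = fun x => x from rfl, this]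

theorem specForm_id_hs (X : Matrix ι ι ℂ) :
    specForm (modBasis hσ hρ) (modEigen hσ hρ) id (hs X) = (Xᴴ * (σ * X * ginv ρ)).trace.re := by
  rw [← re_inner_specApply, specApply_id_hs, ← inner_conj_symm, Complex.conj_re, inner_hs]

/-- The Kronecker product of the positive roots is a positive root of the modular operator, and such
a root is unique. -/
theorem specApply_sqrt_hs (X : Matrix ι ι ℂ) :
    specApply (modBasis hσ hρ) (modEigen hσ hρ) Real.sqrt (hs X) =
      hs (msqrt σ * X * ginvSqrt ρ) := by
  rw [← kronecker_transpose_mulVec_hs, modBasis, modEigen, ← toLp_cfc_mulVec]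
  have h := cfc_sqrt_eq ((msqrt_posSemidef (A := σ)).kronecker
    (ginvSqrt_posSemidef (A := ρ)).transpose)
  rw [← mul_kronecker_mul, ← transpose_mul, msqrt_mul_msqrt hσ, ginvSqrt_mul_ginvSqrt hρ] at h
  rw [h]

theorem quasiEntropy_eq_specForm {f : ℝ → ℝ} {K : Matrix ι ι ℂ}
    (h : BddAbove (f '' Ioi 0) ∨ ∀ x : ι → ℂ, σ *ᵥ x = 0 → (K * ρ * Kᴴ) *ᵥ x = 0) :
    quasiEntropy f K ρ σ =
      ((specForm (modBasis hσ hρ) (modEigen hσ hρ) (extZero f) (hs (K * msqrt ρ)) : ℝ) : EReal) := by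
  rw [quasiEntropy, if_pos h, specForm_hs, conjTranspose_mul, msqrt_isHermitian.eq]

/-- Under the kernel inclusion `v = K ρ^{1/2}` is in the range of the modular operator, namely `v =
Δ(σ⁻¹ v ρ)`, hence orthogonal to its null vectors. -/
theorem inner_modBasis_eq_zero {K : Matrix ι ι ℂ}
    (h : ∀ x : ι → ℂ, σ *ᵥ x = 0 → (K * ρ * Kᴴ) *ᵥ x = 0) {i : ι × ι}
    (hi : modEigen hσ hρ i = 0) : inner ℂ (modBasis hσ hρ i) (hs (K * msqrt ρ)) = 0 := by
  have h1 := eq_mul_supp_of_ker hσ.1 h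
  set s := msqrt ρ with hs'
  have hsh : sᴴ = s := msqrt_isHermitian.eq
  have hQ : (supp σ)ᴴ = supp σ := supp_isHermitian.eq
  have h2 : supp σ * (K * s) = K * s := by
    rw [← sub_eq_zero, ← neg_eq_zero, neg_sub]
    apply hs_eq_zero_of_trace
    rw [trace_mul_comm]
    -- With `Q = supp σ` this is `(1 - Q) K ρ K* (1 - Q)`, which vanishes because `K ρ K* Q = K ρ
    -- K*`.
    have h3 : (K * s - supp σ * (K * s)) * (K * s - supp σ * (K * s))ᴴ =
        (K * ρ * Kᴴ - K * ρ * Kᴴ * supp σ) - supp σ * (K * ρ * Kᴴ - K * ρ * Kᴴ * supp σ) := by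
      simp only [conjTranspose_sub, conjTranspose_mul, hsh, hQ]
      rw [← msqrt_mul_msqrt hρ, ← hs']
      noncomm_ring
    rw [h3, h1]
    simp
  have h4 : hs (K * s) = specApply (modBasis hσ hρ) (modEigen hσ hρ) id
      (hs (ginv σ * (K * s) * ρ)) := by
    rw [specApply_id_hs]
    congr 1
    have : σ * (ginv σ * (K * s) * ρ) * ginv ρ = (σ * ginv σ) * (K * s) * (ρ * ginv ρ) := by
      noncomm_ring
    rw [this, self_mul_ginv hσ.1, self_mul_ginv hρ.1, h2, mul_assoc, hs', msqrt_mul_supp]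
  rw [h4, inner_specApply]
  simp [hi]

end Modular

/-! ### Hilbert-Schmidt, operator and trace norms -/

section Norms

variable {ι : Type*} [Fintype ι] [DecidableEq ι]

theorem norm_hs_sq_eq_sum (X : Matrix ι ι ℂ) :
    ‖hs X‖ ^ 2 = ∑ j, ‖WithLp.toLp 2 (fun i => X i j)‖ ^ 2 := by
  simp only [EuclideanSpace.norm_sq_eq, hs_apply, Fintype.sum_prod_type]
  exact Finset.sum_comm

theorem opNorm_nonneg (A : Matrix ι ι ℂ) : 0 ≤ opNorm A := norm_nonneg _

theorem norm_hs_mul_le (A B : Matrix ι ι ℂ) : ‖hs (A * B)‖ ≤ opNorm A * ‖hs B‖ := by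
  refine le_of_sq_le_sq ?_ (mul_nonneg (opNorm_nonneg A) (norm_nonneg _))
  rw [mul_pow, norm_hs_sq_eq_sum, norm_hs_sq_eq_sum, Finset.mul_sum]
  refine Finset.sum_le_sum fun j _ => ?_
  rw [← mul_pow]
  exact pow_le_pow_left₀ (norm_nonneg _)
    ((Matrix.toEuclideanCLM (n := ι) (𝕜 := ℂ) A).le_opNorm (WithLp.toLp 2 fun i => B i j)) 2

open scoped Matrix.Norms.L2Operator in
theorem opNorm_conjTranspose (A : Matrix ι ι ℂ) : opNorm Aᴴ = opNorm A :=
  Matrix.l2_opNorm_conjTranspose A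

theorem norm_hs_mul_le' (A B : Matrix ι ι ℂ) : ‖hs (A * B)‖ ≤ ‖hs A‖ * opNorm B := by
  rw [← norm_hs_conjTranspose, conjTranspose_mul, ← norm_hs_conjTranspose A,
    ← opNorm_conjTranspose B, mul_comm]
  exact norm_hs_mul_le _ _

theorem opNorm_cfc_le {A : Matrix ι ι ℂ} (hA : A.IsHermitian) {g : ℝ → ℝ} {r : ℝ} (hr : 0 ≤ r)
    (hg : ∀ i, |g (hA.eigenvalues i)| ≤ r) : opNorm (cfc g A) ≤ r := by
  refine ContinuousLinearMap.opNorm_le_bound _ hr fun x => ?_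
  have h1 : Matrix.toEuclideanCLM (n := ι) (𝕜 := ℂ) (cfc g A) x =
      specApply hA.eigenvectorBasis hA.eigenvalues g x := by
    rw [← toLp_cfc_mulVec]; rfl
  rw [h1]
  refine (norm_specApply_le _ _ (h := fun _ => r) x hg).trans (le_of_eq ?_)
  have := specApply_const_mul hA.eigenvectorBasis hA.eigenvalues r (fun _ => 1) x
  rw [specApply_one] at this
  simp only [mul_one] at this
  rw [this, norm_smul, Real.norm_of_nonneg hr]

/-- With `H = Y*Y - X*X = Y*(Y - X) + (Y - X)*X` and `S = sgn H`, one has `|H| = S H`;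
Cauchy-Schwarz on each summand and `‖S‖ ≤ 1` finish. -/
theorem traceNorm_sub_le (X Y : Matrix ι ι ℂ) :
    traceNorm (Yᴴ * Y - Xᴴ * X) ≤ (‖hs X‖ + ‖hs Y‖) * ‖hs (X - Y)‖ := by
  set H := Yᴴ * Y - Xᴴ * X with hH
  have hHh : H.IsHermitian :=
    (isHermitian_conjTranspose_mul_self Y).sub (isHermitian_conjTranspose_mul_self X)
  set sgn : ℝ → ℝ := fun x => if 0 ≤ x then 1 else -1 with hsgn
  set S := cfc sgn H with hS
  have hSh : Sᴴ = S := (isHermitian_cfc H sgn).eq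
  have hS1 : opNorm S ≤ 1 := opNorm_cfc_le hHh zero_le_one fun i => by
    simp only [hsgn]; split_ifs <;> simp
  have h1 : msqrt (Hᴴ * H) = S * H := by
    have e1 : Hᴴ * H = cfc (fun x : ℝ => x * x) H := by
      rw [← cfc_mul_cfc, cfc_id_of_isHermitian hHh, hHh.eq]
    have e2 := cfc_comp' Real.sqrt (fun x : ℝ => x * x) H
      ((H.finite_real_spectrum.image _).continuousOn _) (continuousOn_spectrum H _) hHh
    have e3 : S * H = cfc (fun x : ℝ => sgn x * x) H := by
      rw [← cfc_mul_cfc, cfc_id_of_isHermitian hHh]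
    rw [msqrt, e1, e3]
    refine e2.symm.trans (cfc_congr fun x _ => ?_)
    simp only [hsgn, Real.sqrt_mul_self_eq_abs]
    split_ifs with h
    · rw [abs_of_nonneg h, one_mul]
    · rw [abs_of_neg (not_le.mp h), neg_one_mul]
  have hMS : ∀ Z : Matrix ι ι ℂ, ‖hs (Z * S)‖ ≤ ‖hs Z‖ := fun Z =>
    (norm_hs_mul_le' Z S).trans (mul_le_of_le_one_right (norm_nonneg _) hS1)
  have h2 : (S * H).trace = inner ℂ (hs (Y * S)) (hs (Y - X)) +
      inner ℂ (hs (Y - X)) (hs (X * S)) := by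
    rw [inner_hs, inner_hs, conjTranspose_mul, hSh, ← mul_assoc (Y - X)ᴴ,
      trace_mul_comm ((Y - X)ᴴ * X) S, ← trace_add, hH, conjTranspose_sub]
    congr 1
    noncomm_ring
  have h3 : ∀ a b : EuclideanSpace ℂ (ι × ι), (inner ℂ a b).re ≤ ‖a‖ * ‖b‖ :=
    fun a b => re_inner_le_norm (𝕜 := ℂ) a b
  have h4 : ‖hs (Y - X)‖ = ‖hs (X - Y)‖ := by
    rw [← neg_sub, map_neg, norm_neg]
  rw [traceNorm, h1, h2, Complex.add_re]
  have h5 := h3 (hs (Y * S)) (hs (Y - X))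
  have h6 := h3 (hs (Y - X)) (hs (X * S))
  rw [h4] at h5 h6
  have h7 := mul_le_mul_of_nonneg_right (hMS Y) (norm_nonneg (hs (X - Y)))
  have h8 := mul_le_mul_of_nonneg_left (hMS X) (norm_nonneg (hs (X - Y)))
  linarith

end Norms

/-! ### Eigenvalue bounds for states -/

section States

variable {ι : Type*} [Fintype ι] [DecidableEq ι] {ρ : Matrix ι ι ℂ}

theorem IsState.sum_eigenvalues (hρ : IsState ρ) : ∑ i, hρ.posSemidef.1.eigenvalues i = 1 := by
  have := hρ.posSemidef.1.trace_eq_sum_eigenvalues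
  rw [hρ.trace_eq_one] at this
  apply Complex.ofReal_injective
  rw [Complex.ofReal_sum, Complex.ofReal_one]
  exact this.symm

theorem IsState.eigenvalues_le_one (hρ : IsState ρ) (i : ι) :
    hρ.posSemidef.1.eigenvalues i ≤ 1 := by
  rw [← hρ.sum_eigenvalues]
  exact Finset.single_le_sum (f := hρ.posSemidef.1.eigenvalues)
    (fun j _ => hρ.posSemidef.eigenvalues_nonneg j) (Finset.mem_univ i)

theorem IsState.exists_minNonzeroEigenvalue (hρ : IsState ρ) :
    0 < minNonzeroEigenvalue ρ ∧ minNonzeroEigenvalue ρ ≤ 1 ∧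
      ∀ i, hρ.posSemidef.1.eigenvalues i ≠ 0 →
        minNonzeroEigenvalue ρ ≤ hρ.posSemidef.1.eigenvalues i := by
  have hfin : {x : ℝ | x ∈ spectrum ℝ ρ ∧ x ≠ 0}.Finite :=
    ρ.finite_real_spectrum.subset fun x hx => hx.1
  have hmem : ∀ i, hρ.posSemidef.1.eigenvalues i ≠ 0 →
      hρ.posSemidef.1.eigenvalues i ∈ {x : ℝ | x ∈ spectrum ℝ ρ ∧ x ≠ 0} := fun i hi =>
    ⟨hρ.posSemidef.1.eigenvalues_mem_spectrum_real i, hi⟩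
  have hle : ∀ i, hρ.posSemidef.1.eigenvalues i ≠ 0 →
      minNonzeroEigenvalue ρ ≤ hρ.posSemidef.1.eigenvalues i := fun i hi =>
    csInf_le hfin.bddBelow (hmem i hi)
  obtain ⟨i, hi⟩ : ∃ i, hρ.posSemidef.1.eigenvalues i ≠ 0 := by
    by_contra! hcon
    have := hρ.sum_eigenvalues
    simp [hcon] at this
  refine ⟨?_, (hle i hi).trans (hρ.eigenvalues_le_one i), hle⟩
  have hin := Set.Nonempty.csInf_mem ⟨_, hmem i hi⟩ hfin
  exact lt_of_le_of_ne (spectrum_nonneg hρ.posSemidef hin.1) (Ne.symm hin.2)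

theorem IsState.norm_hs_msqrt (hρ : IsState ρ) : ‖hs (msqrt ρ)‖ = 1 := by
  rw [← sq_eq_sq₀ (norm_nonneg _) zero_le_one, norm_hs_sq, msqrt_isHermitian.eq,
    msqrt_mul_msqrt hρ.posSemidef, hρ.trace_eq_one]
  simp

theorem IsState.opNorm_msqrt_le (hρ : IsState ρ) : opNorm (msqrt ρ) ≤ 1 :=
  opNorm_cfc_le hρ.posSemidef.1 zero_le_one fun i => by
    rw [abs_of_nonneg (Real.sqrt_nonneg _)]
    exact Real.sqrt_le_one.mpr (hρ.eigenvalues_le_one i)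

theorem IsState.norm_hs_le (hρ : IsState ρ) : ‖hs ρ‖ ≤ 1 := by
  rw [← msqrt_mul_msqrt hρ.posSemidef]
  refine (norm_hs_mul_le _ _).trans ?_
  rw [hρ.norm_hs_msqrt, mul_one]
  exact hρ.opNorm_msqrt_le

/-- The sharp value would be `λ^{-1/2}`; as `λ ≤ 1`, the cruder `1/λ` used in the final constant is
larger. -/
theorem IsState.opNorm_ginvSqrt_le (hρ : IsState ρ) :
    opNorm (ginvSqrt ρ) ≤ 1 / minNonzeroEigenvalue ρ := by
  obtain ⟨h0, h1, h2⟩ := hρ.exists_minNonzeroEigenvalue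
  refine opNorm_cfc_le hρ.posSemidef.1 (by positivity) fun i => ?_
  rw [abs_of_nonneg (by positivity)]
  by_cases hi : hρ.posSemidef.1.eigenvalues i = 0
  · rw [hi]; simp [h0.le]
  · rw [← one_div]
    refine one_div_le_one_div_of_le h0 (Real.le_sqrt_of_sq_le ?_)
    nlinarith [h2 i hi]

end States

/-! ### Partial trace by duality -/

section PartialTrace

variable {m n : Type*} [Fintype m] [DecidableEq m] [Fintype n] [DecidableEq n]

/-- This duality with `Z ↦ Z ⊗ 1` characterizes the partial trace, so later identities are checked
by pairing with `Z`. -/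
theorem trace_mul_kronecker_one (A : Matrix (m × n) (m × n) ℂ) (Z : Matrix m m ℂ) :
    (A * (Z ⊗ₖ (1 : Matrix n n ℂ))).trace = (ptrace₂ A * Z).trace := by
  simp only [Matrix.trace, Matrix.diag, Matrix.mul_apply, Fintype.sum_prod_type, ptrace₂,
    Matrix.of_apply, kronecker_apply, Matrix.one_apply, Finset.sum_mul]
  refine Finset.sum_congr rfl fun i _ => ?_
  rw [Finset.sum_comm]
  refine Finset.sum_congr rfl fun j _ => ?_
  simp

theorem ptrace_ext {A : Matrix (m × n) (m × n) ℂ} {B : Matrix m m ℂ}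
    (h : ∀ Z, (A * (Z ⊗ₖ (1 : Matrix n n ℂ))).trace = (B * Z).trace) : ptrace₂ A = B :=
  ext_iff_trace_mul_right.mpr fun Z => by rw [← trace_mul_kronecker_one, h]

theorem trace_ptrace (A : Matrix (m × n) (m × n) ℂ) : (ptrace₂ A).trace = A.trace := by
  have := trace_mul_kronecker_one A 1
  rw [one_kronecker_one, mul_one, mul_one] at this
  exact this.symm

theorem ptrace_mul_kronecker_one (A : Matrix (m × n) (m × n) ℂ) (Q : Matrix m m ℂ) :
    ptrace₂ (A * (Q ⊗ₖ (1 : Matrix n n ℂ))) = ptrace₂ A * Q :=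
  ptrace_ext fun Z => by
    rw [mul_assoc, ← mul_kronecker_mul, mul_one, trace_mul_kronecker_one, mul_assoc]

theorem ptrace_conj {V : Matrix n n ℂ} (hV : V * Vᴴ = 1) (L R : Matrix m m ℂ)
    (A : Matrix (m × n) (m × n) ℂ) :
    ptrace₂ ((L ⊗ₖ Vᴴ) * A * (R ⊗ₖ V)) = L * ptrace₂ A * R :=
  ptrace_ext fun Z => by
    rw [mul_assoc, mul_assoc, trace_mul_comm, mul_assoc, mul_assoc, ← mul_kronecker_mul,
      ← mul_kronecker_mul, one_mul, hV, trace_mul_kronecker_one, mul_assoc L, mul_assoc L,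
      trace_mul_comm L, mul_assoc, mul_assoc]

theorem ptrace_posSemidef {A : Matrix (m × n) (m × n) ℂ} (hA : A.PosSemidef) :
    (ptrace₂ A).PosSemidef := by
  have : ptrace₂ A = ∑ k, A.submatrix (fun i => (i, k)) (fun i => (i, k)) := by
    ext i j
    simp [ptrace₂, Matrix.sum_apply]
  rw [this]
  exact posSemidef_sum _ fun k _ => hA.submatrix _

/-- For `Q = 1 - supp ρ₁`, the squared Hilbert-Schmidt norm of `(Q ⊗ 1) ρ^{1/2}` is `Tr(ρ₁ Q) = 0`.
-/
theorem kronecker_supp_mul_msqrt {ρ : Matrix (m × n) (m × n) ℂ} (hρ : ρ.PosSemidef) :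
    (supp (ptrace₂ ρ) ⊗ₖ (1 : Matrix n n ℂ)) * msqrt ρ = msqrt ρ := by
  set Q := 1 - supp (ptrace₂ ρ) with hQ
  have hQh : Qᴴ = Q := by rw [hQ, conjTranspose_sub, supp_isHermitian.eq, conjTranspose_one]
  have hkey : ptrace₂ ρ * Q = 0 := by
    rw [hQ, mul_sub, mul_one, self_mul_supp (ptrace_posSemidef hρ).1, sub_self]
  have h0 : (Q ⊗ₖ (1 : Matrix n n ℂ)) * msqrt ρ = 0 := by
    rw [← conjTranspose_eq_zero]
    apply hs_eq_zero_of_trace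
    rw [conjTranspose_conjTranspose, conjTranspose_mul, msqrt_isHermitian.eq,
      conjTranspose_kronecker, hQh, conjTranspose_one, mul_assoc, ← mul_assoc (msqrt ρ),
      msqrt_mul_msqrt hρ, trace_mul_comm, mul_assoc, ← mul_kronecker_mul, one_mul,
      trace_mul_kronecker_one, ← mul_assoc, hkey, zero_mul, trace_zero]
  have h1 : (Q ⊗ₖ (1 : Matrix n n ℂ)) =
      1 - (supp (ptrace₂ ρ) ⊗ₖ (1 : Matrix n n ℂ)) := by
    rw [eq_sub_iff_add_eq, ← add_kronecker, hQ, sub_add_cancel, one_kronecker_one]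
  rw [h1, sub_mul, one_mul, sub_eq_zero] at h0
  exact h0.symm

/-- Inclusion of kernels passes to partial traces. -/
theorem ptrace_mul_supp {ρ G : Matrix (m × n) (m × n) ℂ} (hρ : ρ.PosSemidef)
    (hG : G * supp ρ = G) : ptrace₂ G * supp (ptrace₂ ρ) = ptrace₂ G := by
  have h1 := congrArg conjTranspose (kronecker_supp_mul_msqrt hρ)
  rw [conjTranspose_mul, msqrt_isHermitian.eq, conjTranspose_kronecker, supp_isHermitian.eq,
    conjTranspose_one] at h1
  rw [← ptrace_mul_kronecker_one]
  congr 1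
  rw [← hG, ← ginvSqrt_mul_msqrt hρ, mul_assoc, mul_assoc, h1]

end PartialTrace

/-! ### The lifting contraction and the Petz map -/

section Recovery

variable {m n : Type*} [Fintype m] [DecidableEq m] [Fintype n] [DecidableEq n]

/-- The map `X ↦ (X ρ₁^{-1/2} ⊗ V) ρ^{1/2}` of Hilbert-Schmidt spaces. -/
noncomputable def liftMap (ρ : Matrix (m × n) (m × n) ℂ) (V : Matrix n n ℂ) :
    Matrix m m ℂ →ₗ[ℂ] Matrix (m × n) (m × n) ℂ where
  toFun X := ((X * ginvSqrt (ptrace₂ ρ)) ⊗ₖ V) * msqrt ρ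
  map_add' X Y := by rw [add_mul, add_kronecker, add_mul]
  map_smul' c X := by simp [smul_kronecker]

theorem liftMap_apply (ρ : Matrix (m × n) (m × n) ℂ) (V : Matrix n n ℂ) (X : Matrix m m ℂ) :
    liftMap ρ V X = ((X * ginvSqrt (ptrace₂ ρ)) ⊗ₖ V) * msqrt ρ := rfl

variable {ρ σ : Matrix (m × n) (m × n) ℂ} {V : Matrix n n ℂ}

theorem conjTranspose_liftMap (X : Matrix m m ℂ) :
    (liftMap ρ V X)ᴴ = msqrt ρ * ((ginvSqrt (ptrace₂ ρ) * Xᴴ) ⊗ₖ Vᴴ) := by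
  rw [liftMap_apply, conjTranspose_mul, conjTranspose_kronecker, conjTranspose_mul,
    msqrt_isHermitian.eq, ginvSqrt_isHermitian.eq]

/-- Taking `Z = K₁` gives `W* v = v'`; taking `Z = X ρ₁^{-1/2}` gives the norm of `W X`. -/
theorem trace_conjTranspose_liftMap_mul (hρ : ρ.PosSemidef) (hV : Vᴴ * V = 1)
    (X Z : Matrix m m ℂ) :
    ((liftMap ρ V X)ᴴ * ((Z ⊗ₖ V) * msqrt ρ)).trace = (Xᴴ * Z * msqrt (ptrace₂ ρ)).trace := by
  rw [conjTranspose_liftMap, mul_assoc, ← mul_assoc _ _ (msqrt ρ), ← mul_kronecker_mul, hV,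
    ← mul_assoc, trace_mul_comm, ← mul_assoc, msqrt_mul_msqrt hρ, trace_mul_kronecker_one,
    ← mul_assoc, ← mul_assoc, self_mul_ginvSqrt (ptrace_posSemidef hρ), mul_assoc, trace_mul_comm]

theorem opNorm_supp_le {ι : Type*} [Fintype ι] [DecidableEq ι] {A : Matrix ι ι ℂ}
    (hA : A.IsHermitian) : opNorm (supp A) ≤ 1 :=
  opNorm_cfc_le hA zero_le_one fun i => by
    by_cases h : hA.eigenvalues i = 0 <;> simp [h]

theorem norm_hs_mul_supp_le {ι : Type*} [Fintype ι] [DecidableEq ι] {A : Matrix ι ι ℂ}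
    (hA : A.IsHermitian) (X : Matrix ι ι ℂ) : ‖hs (X * supp A)‖ ≤ ‖hs X‖ :=
  (norm_hs_mul_le' _ _).trans (mul_le_of_le_one_right (norm_nonneg _) (opNorm_supp_le hA))

theorem norm_hs_mul_supp_sq {ι : Type*} [Fintype ι] [DecidableEq ι] {A : Matrix ι ι ℂ}
    (X : Matrix ι ι ℂ) : ‖hs (X * supp A)‖ ^ 2 = (Xᴴ * X * supp A).trace.re := by
  rw [norm_hs_sq, conjTranspose_mul, supp_isHermitian.eq, mul_assoc, trace_mul_comm, mul_assoc,
    mul_assoc, supp_mul_supp, mul_assoc]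

theorem conjTranspose_msqrt_mul_self {ι : Type*} [Fintype ι] [DecidableEq ι] {A : Matrix ι ι ℂ}
    (hA : A.PosSemidef) (X : Matrix ι ι ℂ) : (msqrt A * X)ᴴ * (msqrt A * X) = Xᴴ * A * X := by
  rw [conjTranspose_mul, msqrt_isHermitian.eq, mul_assoc, ← mul_assoc (msqrt A),
    msqrt_mul_msqrt hA, mul_assoc]

theorem norm_hs_msqrt_mul_sq {ι : Type*} [Fintype ι] [DecidableEq ι] {A : Matrix ι ι ℂ}
    (hA : A.PosSemidef) (X : Matrix ι ι ℂ) :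
    ‖hs (msqrt A * X)‖ ^ 2 = (Xᴴ * A * X).trace.re := by
  rw [norm_hs_sq, conjTranspose_msqrt_mul_self hA]

/-- In fact `‖W X‖ = ‖X supp ρ₁‖`, so `W` is a partial isometry. -/
theorem norm_hs_liftMap_le (hρ : ρ.PosSemidef) (hV : Vᴴ * V = 1) (X : Matrix m m ℂ) :
    ‖hs (liftMap ρ V X)‖ ≤ ‖hs X‖ := by
  refine le_trans (le_of_eq ?_) (norm_hs_mul_supp_le (ptrace_posSemidef hρ).1 X)
  rw [← sq_eq_sq₀ (norm_nonneg _) (norm_nonneg _), norm_hs_mul_supp_sq, norm_hs_sq]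
  nth_rewrite 2 [liftMap_apply]
  rw [trace_conjTranspose_liftMap_mul hρ hV, ← mul_assoc, mul_assoc,
    ginvSqrt_mul_msqrt (ptrace_posSemidef hρ)]

theorem specForm_id_hs_mul_msqrt {ι : Type*} [Fintype ι] [DecidableEq ι] {σ ρ : Matrix ι ι ℂ}
    (hσ : σ.PosSemidef) (hρ : ρ.PosSemidef) (Z : Matrix ι ι ℂ) :
    specForm (modBasis hσ hρ) (modEigen hσ hρ) id (hs (Z * msqrt ρ)) =
      (Zᴴ * σ * Z * supp ρ).trace.re := by
  rw [specForm_id_hs, conjTranspose_mul, msqrt_isHermitian.eq, mul_assoc, trace_mul_comm]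
  have : Zᴴ * (σ * (Z * msqrt ρ) * ginv ρ) * msqrt ρ =
      Zᴴ * σ * Z * (msqrt ρ * ginv ρ * msqrt ρ) := by noncomm_ring
  rw [this, msqrt_mul_ginv hρ, ginvSqrt_mul_msqrt hρ]

theorem ptrace_conj_mul (hV : V * Vᴴ = 1) (L R : Matrix m m ℂ) (σ : Matrix (m × n) (m × n) ℂ) :
    ((L ⊗ₖ V)ᴴ * σ * (R ⊗ₖ V)).trace = (Lᴴ * ptrace₂ σ * R).trace := by
  rw [← trace_ptrace, conjTranspose_kronecker, ptrace_conj hV]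

/-- With `Z = X ρ₁^{-1/2} ⊗ V` the two sides are `‖σ^{1/2} Z supp ρ‖²` and `‖σ^{1/2} Z‖²`; only the
support projection of `ρ` separates them. -/
theorem specForm_liftMap_le (hσ : σ.PosSemidef) (hρ : ρ.PosSemidef) (hV : V * Vᴴ = 1)
    (X : Matrix m m ℂ) :
    specForm (modBasis hσ hρ) (modEigen hσ hρ) id (hs (liftMap ρ V X)) ≤
      specForm (modBasis (ptrace_posSemidef hσ) (ptrace_posSemidef hρ))
        (modEigen (ptrace_posSemidef hσ) (ptrace_posSemidef hρ)) id (hs X) := by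
  rw [liftMap_apply, specForm_id_hs_mul_msqrt, specForm_id_hs]
  set Z := (X * ginvSqrt (ptrace₂ ρ)) ⊗ₖ V with hZ
  have h1 : (Zᴴ * σ * Z * supp ρ).trace.re = ‖hs (msqrt σ * Z * supp ρ)‖ ^ 2 := by
    rw [norm_hs_mul_supp_sq, conjTranspose_msqrt_mul_self hσ]
  have h2 : (Xᴴ * (ptrace₂ σ * X * ginv (ptrace₂ ρ))).trace.re = ‖hs (msqrt σ * Z)‖ ^ 2 := by
    rw [norm_hs_msqrt_mul_sq hσ, hZ, ptrace_conj_mul hV, conjTranspose_mul,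
      ginvSqrt_isHermitian.eq, mul_assoc _ Xᴴ, mul_assoc (ginvSqrt _), trace_mul_comm (ginvSqrt _),
      ← ginvSqrt_mul_ginvSqrt (ptrace_posSemidef hρ)]
    simp only [mul_assoc]
  rw [h1, h2]
  exact pow_le_pow_left₀ (norm_nonneg _) (norm_hs_mul_supp_le hρ.1 _) 2

theorem msqrt_mul_mul_supp {ι : Type*} [Fintype ι] [DecidableEq ι] {σ ρ K : Matrix ι ι ℂ}
    (hσ : σ.PosSemidef) (h : Kᴴ * σ * K * supp ρ = Kᴴ * σ * K) :
    msqrt σ * K * supp ρ = msqrt σ * K := by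
  rw [← sub_eq_zero]
  apply hs_eq_zero_of_trace
  have h1 : (msqrt σ * K * supp ρ - msqrt σ * K)ᴴ * (msqrt σ * K * supp ρ - msqrt σ * K) =
      supp ρ * (Kᴴ * (msqrt σ * msqrt σ) * K * supp ρ - Kᴴ * (msqrt σ * msqrt σ) * K) -
        (Kᴴ * (msqrt σ * msqrt σ) * K * supp ρ - Kᴴ * (msqrt σ * msqrt σ) * K) := by
    simp only [conjTranspose_sub, conjTranspose_mul, msqrt_isHermitian.eq, supp_isHermitian.eq]
    noncomm_ring
  rw [h1, msqrt_mul_msqrt hσ, h]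
  simp

variable {K₁ : Matrix m m ℂ}

theorem ptrace_conjTranspose_conj (hV : V * Vᴴ = 1) :
    ptrace₂ ((K₁ ⊗ₖ V)ᴴ * σ * (K₁ ⊗ₖ V)) = K₁ᴴ * ptrace₂ σ * K₁ := by
  rw [conjTranspose_kronecker, ptrace_conj hV]

theorem liftMap_mul_supp (X : Matrix m m ℂ) :
    liftMap ρ V (X * supp (ptrace₂ ρ)) = liftMap ρ V X := by
  rw [liftMap_apply, mul_assoc, supp_mul_ginvSqrt, liftMap_apply]

theorem compression_liftMap (hσ : σ.PosSemidef) (hρ : ρ.PosSemidef) (hV : V * Vᴴ = 1)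
    (hV' : Vᴴ * V = 1) (K₁ : Matrix m m ℂ) :
    Compression (modBasis hσ hρ) (modEigen hσ hρ)
      (modBasis (ptrace_posSemidef hσ) (ptrace_posSemidef hρ))
      (modEigen (ptrace_posSemidef hσ) (ptrace_posSemidef hρ))
      (hs.toLinearMap ∘ₗ liftMap ρ V ∘ₗ hs.symm.toLinearMap)
      (hs ((K₁ ⊗ₖ V) * msqrt ρ)) (hs (K₁ * msqrt (ptrace₂ ρ))) where
  nonneg := modEigen_nonneg hσ hρ
  nonneg' := modEigen_nonneg _ _
  contraction x := by
    obtain ⟨X, rfl⟩ := hs.surjective x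
    simpa using norm_hs_liftMap_le hρ hV' X
  form_le x := by
    obtain ⟨X, rfl⟩ := hs.surjective x
    simpa using specForm_liftMap_le hσ hρ hV X
  map_vec := by
    simp only [LinearMap.comp_apply, LinearEquiv.coe_coe, LinearEquiv.symm_apply_apply]
    congr 1
    rw [liftMap_apply, mul_assoc K₁, msqrt_mul_ginvSqrt (ptrace_posSemidef hρ)]
    have : (K₁ * supp (ptrace₂ ρ)) ⊗ₖ V =
        (K₁ ⊗ₖ V) * (supp (ptrace₂ ρ) ⊗ₖ (1 : Matrix n n ℂ)) := by
      rw [← mul_kronecker_mul, mul_one]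
    rw [this, mul_assoc, kronecker_supp_mul_msqrt hρ]
  adjoint_vec x := by
    obtain ⟨X, rfl⟩ := hs.surjective x
    simp only [LinearMap.comp_apply, LinearEquiv.coe_coe, LinearEquiv.symm_apply_apply]
    rw [inner_hs, inner_hs, trace_conjTranspose_liftMap_mul hρ hV', mul_assoc]

/-- The reduced modular vector is the compression of the full one, hence not longer. -/
theorem norm_reduced_modular_le (hσ : σ.PosSemidef) (hρ : ρ.PosSemidef) (hV : V * Vᴴ = 1)
    (hV' : Vᴴ * V = 1)
    (hG : (K₁ ⊗ₖ V)ᴴ * σ * (K₁ ⊗ₖ V) * supp ρ = (K₁ ⊗ₖ V)ᴴ * σ * (K₁ ⊗ₖ V)) :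
    ‖hs (ptrace₂ σ * K₁ * ginvSqrt (ptrace₂ ρ))‖ ≤ ‖hs (σ * (K₁ ⊗ₖ V) * ginvSqrt ρ)‖ := by
  -- That is, `W*` sends `σ K ρ^{-1/2}` to `σ₁ K₁ ρ₁^{-1/2}`. Hence the final constant needs no
  -- eigenvalue bound for `ρ₁`.
  have h1 : ∀ X : Matrix m m ℂ, inner ℂ (hs X) (hs (ptrace₂ σ * K₁ * ginvSqrt (ptrace₂ ρ))) =
      inner ℂ (hs (liftMap ρ V X)) (hs (σ * (K₁ ⊗ₖ V) * ginvSqrt ρ)) := by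
    intro X
    have h2 : σ * (K₁ ⊗ₖ V) * supp ρ = σ * (K₁ ⊗ₖ V) := by
      nth_rewrite 1 [← msqrt_mul_msqrt hσ]
      rw [mul_assoc (msqrt σ), mul_assoc (msqrt σ), msqrt_mul_mul_supp hσ hG, ← mul_assoc,
        msqrt_mul_msqrt hσ]
    rw [inner_hs, inner_hs, conjTranspose_liftMap, mul_assoc (msqrt ρ), trace_mul_comm (msqrt ρ),
      mul_assoc _ (σ * _ * _), mul_assoc (σ * _), ginvSqrt_mul_msqrt hρ, h2]
    have h3 := ptrace_conj_mul hV (X * ginvSqrt (ptrace₂ ρ)) K₁ σ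
    rw [conjTranspose_kronecker, conjTranspose_mul, ginvSqrt_isHermitian.eq] at h3
    rw [← mul_assoc _ σ, h3, mul_assoc _ Xᴴ, mul_assoc (ginvSqrt _), trace_mul_comm (ginvSqrt _)]
    simp only [mul_assoc]
  set Y := ptrace₂ σ * K₁ * ginvSqrt (ptrace₂ ρ) with hY
  have h4 := h1 Y
  have h5 : ‖hs Y‖ ^ 2 ≤ ‖hs Y‖ * ‖hs (σ * (K₁ ⊗ₖ V) * ginvSqrt ρ)‖ := by
    have h6 : ‖hs Y‖ ^ 2 = ‖inner ℂ (hs Y) (hs Y)‖ := by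
      rw [inner_self_eq_norm_sq_to_K]; simp
    rw [h6, h4]
    exact (norm_inner_le_norm _ _).trans
      (mul_le_mul_of_nonneg_right (norm_hs_liftMap_le hρ hV' Y) (norm_nonneg _))
  rcases (norm_nonneg (hs Y)).eq_or_lt with h0 | h0
  · rw [← h0]; exact norm_nonneg _
  · rw [sq] at h5
    exact le_of_mul_le_mul_left h5 h0

theorem conjTranspose_liftMap_mul_self (hσ : σ.PosSemidef) (hV' : Vᴴ * V = 1) :
    (liftMap ρ V (msqrt (ptrace₂ σ) * K₁))ᴴ * liftMap ρ V (msqrt (ptrace₂ σ) * K₁) =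
      petzMap ρ (K₁ᴴ * ptrace₂ σ * K₁) := by
  rw [conjTranspose_liftMap, liftMap_apply, petzMap, mul_assoc, ← mul_assoc _ _ (msqrt ρ),
    ← mul_kronecker_mul, hV', ← mul_assoc (msqrt ρ)]
  congr 3
  rw [conjTranspose_mul, msqrt_isHermitian.eq]
  nth_rewrite 3 [← msqrt_mul_msqrt (ptrace_posSemidef hσ)]
  noncomm_ring

/-- Finiteness of the entropy passes to the reduced states this way: the inclusion is rewritten with
supports, which survive the partial trace. -/
theorem ker_ptrace {L : Matrix (m × n) (m × n) ℂ} (hσ : σ.PosSemidef)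
    (h : ∀ x, σ *ᵥ x = 0 → L *ᵥ x = 0) (x : m → ℂ) (hx : ptrace₂ σ *ᵥ x = 0) :
    ptrace₂ L *ᵥ x = 0 := by
  rw [← ptrace_mul_supp hσ (eq_mul_supp_of_ker hσ.1 h),
    ← ginv_mul_self (ptrace_posSemidef hσ).1, ← mulVec_mulVec, ← mulVec_mulVec, hx]
  simp

theorem repAt_modEigen {ι : Type*} [Fintype ι] [DecidableEq ι] {σ ρ K : Matrix ι ι ℂ}
    (hσ : σ.PosSemidef) (hρ : ρ.PosSemidef) {f : ℝ → ℝ} {a b : ℝ} {μ : Measure ℝ}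
    (hrep : IsCanonicalRep f a b μ) (hpos : ∀ᵐ t ∂μ, 0 < t)
    (h : BddAbove (f '' Ioi 0) ∨ ∀ x : ι → ℂ, σ *ᵥ x = 0 → (K * ρ * Kᴴ) *ᵥ x = 0)
    (i : ι × ι) (hi : inner ℂ (modBasis hσ hρ i) (hs (K * msqrt ρ)) ≠ 0) :
    RepAt (extZero f) a b μ (modEigen hσ hρ i) := by
  rcases (modEigen_nonneg hσ hρ i).eq_or_lt with h0 | h0
  · rcases h with h | h
    · rw [← h0]
      exact hrep.repAt_extZero_zero hpos h
    · exact absurd (inner_modBasis_eq_zero hσ hρ h h0.symm) hi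
  · exact hrep.repAt_extZero_of_pos hpos h0

end Recovery

end QuasiEntropy

theorem corollary4p4
    {m n : Type*} [Fintype m] [DecidableEq m] [Fintype n] [DecidableEq n]
    (f : ℝ → ℝ) (hf : QuasiEntropy.IsRegular f) (hf1 : f 1 = 0)
    (C c : ℝ) (hC : 0 < C) (hc : 0 < c)
    (hreg : ∀ T : ℝ, 0 < T →
      QuasiEntropy.regConst f T (1 / 2) ≤ ENNReal.ofReal (C * T ^ (2 * c)))
    (K₁ : Matrix m m ℂ) (V : Matrix n n ℂ) (hV : V ∈ Matrix.unitaryGroup n ℂ)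
    (K : Matrix (m × n) (m × n) ℂ) (hK : K = K₁ ⊗ₖ V)
    (ρ σ : Matrix (m × n) (m × n) ℂ)
    (hρ : QuasiEntropy.IsState ρ) (hσ : QuasiEntropy.IsState σ)
    (hsupp : ∀ x : m × n → ℂ, ρ *ᵥ x = 0 → (Kᴴ * σ * K) *ᵥ x = 0)
    (hfin : QuasiEntropy.quasiEntropy f K ρ σ ≠ ⊤) :
    QuasiEntropy.quasiEntropy f K₁ (QuasiEntropy.ptrace₂ ρ) (QuasiEntropy.ptrace₂ σ) ≤
        QuasiEntropy.quasiEntropy f K ρ σ ∧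
      QuasiEntropy.traceNorm
          (QuasiEntropy.petzMap ρ (K₁ᴴ * QuasiEntropy.ptrace₂ σ * K₁) - Kᴴ * σ * K) ≤
        QuasiEntropy.recoveryConst (QuasiEntropy.minNonzeroEigenvalue ρ)
            (QuasiEntropy.opNorm K) C c *
          ((QuasiEntropy.quasiEntropy f K ρ σ).toReal -
            (QuasiEntropy.quasiEntropy f K₁ (QuasiEntropy.ptrace₂ ρ)
              (QuasiEntropy.ptrace₂ σ)).toReal) ^ (1 / (4 * (1 + c))) := by
  open QuasiEntropy in
  have hV1 : V * Vᴴ = 1 := Matrix.mem_unitaryGroup_iff.mp hV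
  have hV2 : Vᴴ * V = 1 := Matrix.mem_unitaryGroup_iff'.mp hV
  have hσp := hσ.posSemidef
  have hρp := hρ.posSemidef
  have hσ1 := ptrace_posSemidef hσp
  have hρ1 := ptrace_posSemidef hρp
  obtain ⟨a, b, hrep⟩ := hf.exists_canonicalRep
  have hpos := ae_pos_of_absolutelyContinuous hf.absolutelyContinuous hrep.half_line
  have hcond : BddAbove (f '' Ioi 0) ∨ ∀ x, σ *ᵥ x = 0 → (K * ρ * Kᴴ) *ᵥ x = 0 := by
    by_contra hcon
    exact hfin (by rw [quasiEntropy, if_neg hcon])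
  have hcond1 : BddAbove (f '' Ioi 0) ∨
      ∀ x, ptrace₂ σ *ᵥ x = 0 → (K₁ * ptrace₂ ρ * K₁ᴴ) *ᵥ x = 0 := by
    refine hcond.imp id fun h x hx => ?_
    have h1 : ptrace₂ (K * ρ * Kᴴ) = K₁ * ptrace₂ ρ * K₁ᴴ := by
      have := ptrace_conj (V := Vᴴ) (by rw [conjTranspose_conjTranspose, hV2]) K₁ K₁ᴴ ρ
      rw [conjTranspose_conjTranspose, ← conjTranspose_kronecker] at this
      rw [hK, this]
    rw [← h1]
    exact ker_ptrace hσp h x hx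
  have hG : Kᴴ * σ * K * supp ρ = Kᴴ * σ * K := eq_mul_supp_of_ker hρp.1 hsupp
  have hptG : ptrace₂ (Kᴴ * σ * K) = K₁ᴴ * ptrace₂ σ * K₁ := by
    rw [hK, ptrace_conjTranspose_conj hV1]
  have hcomp := compression_liftMap hσp hρp hV1 hV2 K₁
  rw [← hK] at hcomp
  have hr := repAt_modEigen hσp hρp hrep hpos hcond
  have hr1 := repAt_modEigen hσ1 hρ1 hrep hpos hcond1
  -- Both sides equal `Tr K* σ K`, since the kernel inclusion for `ρ` absorbs the support
  -- projections.
  have hid : specForm (modBasis hσp hρp) (modEigen hσp hρp) id (hs (K * msqrt ρ)) =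
      specForm (modBasis hσ1 hρ1) (modEigen hσ1 hρ1) id (hs (K₁ * msqrt (ptrace₂ ρ))) := by
    rw [specForm_id_hs_mul_msqrt, specForm_id_hs_mul_msqrt, hG, ← hptG,
      ptrace_mul_supp hρp hG, trace_ptrace]
  have hD := hcomp.defect_nonneg hpos hr hr1 hid
  obtain ⟨hl0, hl1, -⟩ := hρ.exists_minNonzeroEigenvalue
  set lam := minNonzeroEigenvalue ρ with hlam
  set k := opNorm K with hk
  have hk0 : 0 ≤ k := opNorm_nonneg K
  have hv : ‖hs (K * msqrt ρ)‖ ≤ k := by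
    have := norm_hs_mul_le K (msqrt ρ)
    rwa [hρ.norm_hs_msqrt, mul_one] at this
  have hv1 : ‖hs (K₁ * msqrt (ptrace₂ ρ))‖ ≤ k := by
    have := hcomp.norm_eq
    rw [sq_eq_sq₀ (norm_nonneg _) (norm_nonneg _)] at this
    rwa [← this]
  have hdv : ‖hs (σ * K * ginvSqrt ρ)‖ ≤ k * (1 / lam) := by
    refine (norm_hs_mul_le' _ _).trans (mul_le_mul ?_ hρ.opNorm_ginvSqrt_le (opNorm_nonneg _) hk0)
    refine (norm_hs_mul_le' _ _).trans (mul_le_of_le_one_left hk0 hσ.norm_hs_le)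
  have hdv1 : ‖hs (ptrace₂ σ * K₁ * ginvSqrt (ptrace₂ ρ))‖ ≤ k * (1 / lam) := by
    rw [hK] at hG
    refine (norm_reduced_modular_le hσp hρp hV1 hV2 hG).trans ?_
    rw [← hK]
    exact hdv
  -- Two of the four norms are at most `k` and two at most `k / λ`.
  have hA : 2 * (‖hs (K * msqrt ρ)‖ +
      ‖specApply (modBasis hσp hρp) (modEigen hσp hρp) id (hs (K * msqrt ρ))‖ +
      ‖hs (K₁ * msqrt (ptrace₂ ρ))‖ +
      ‖specApply (modBasis hσ1 hρ1) (modEigen hσ1 hρ1) id (hs (K₁ * msqrt (ptrace₂ ρ)))‖) ≤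
      4 * k * (1 + 1 / lam) := by
    rw [specApply_id_hs, specApply_id_hs, ← mul_assoc, ← mul_assoc, mul_assoc (σ * K),
      mul_assoc (ptrace₂ σ * K₁), msqrt_mul_ginv hρp, msqrt_mul_ginv hρ1]
    linarith
  have hreg' := fun T hT => (regConst_half (f := f) T) ▸ hreg T hT
  have main := hcomp.norm_sqrt_diff_le_defect hpos hr hr1 hid hC hc hreg' hA
  rw [quasiEntropy_eq_specForm hσp hρp hcond, quasiEntropy_eq_specForm hσ1 hρ1 hcond1]
  refine ⟨EReal.coe_le_coe_iff.mpr (by linarith), ?_⟩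
  rw [EReal.toReal_coe, EReal.toReal_coe]
  set D := specForm (modBasis hσp hρp) (modEigen hσp hρp) (extZero f) (hs (K * msqrt ρ)) -
    specForm (modBasis hσ1 hρ1) (modEigen hσ1 hρ1) (extZero f)
      (hs (K₁ * msqrt (ptrace₂ ρ))) with hDdef
  have hX : specApply (modBasis hσp hρp) (modEigen hσp hρp) Real.sqrt (hs (K * msqrt ρ)) =
      hs (msqrt σ * K) := by
    rw [specApply_sqrt_hs, ← mul_assoc, mul_assoc, msqrt_mul_ginvSqrt hρp,
      msqrt_mul_mul_supp hσp hG]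
  have hY : (hs.toLinearMap ∘ₗ liftMap ρ V ∘ₗ hs.symm.toLinearMap)
      (specApply (modBasis hσ1 hρ1) (modEigen hσ1 hρ1) Real.sqrt
        (hs (K₁ * msqrt (ptrace₂ ρ)))) = hs (liftMap ρ V (msqrt (ptrace₂ σ) * K₁)) := by
    rw [specApply_sqrt_hs, ← mul_assoc, mul_assoc, msqrt_mul_ginvSqrt hρ1]
    simp only [LinearMap.comp_apply, LinearEquiv.coe_coe, LinearEquiv.symm_apply_apply,
      liftMap_mul_supp]
  rw [hX, hY, ← map_sub] at main
  have hXn : ‖hs (msqrt σ * K)‖ ≤ k := by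
    have := norm_hs_mul_le' (msqrt σ) K
    rwa [hσ.norm_hs_msqrt, one_mul] at this
  have hYn : ‖hs (liftMap ρ V (msqrt (ptrace₂ σ) * K₁))‖ ≤ k := by
    refine (norm_hs_liftMap_le hρp hV2 _).trans (le_trans (le_of_eq ?_) hXn)
    rw [← sq_eq_sq₀ (norm_nonneg _) (norm_nonneg _), norm_hs_msqrt_mul_sq hσ1,
      norm_hs_msqrt_mul_sq hσp, ← hptG, trace_ptrace]
  have hT := traceNorm_sub_le (msqrt σ * K) (liftMap ρ V (msqrt (ptrace₂ σ) * K₁))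
  rw [conjTranspose_liftMap_mul_self hσp hV2, conjTranspose_msqrt_mul_self hσp] at hT
  refine hT.trans ?_
  set d := ‖hs (msqrt σ * K - liftMap ρ V (msqrt (ptrace₂ σ) * K₁))‖ with hd
  have hd0 : 0 ≤ d := norm_nonneg _
  -- Both Hilbert-Schmidt norms are at most `k`; with the factor 2 from the cut-off lemma and the
  -- division by `π` this gives the prefactor `4 k / π`.
  calc _ ≤ (2 * k) * d := mul_le_mul_of_nonneg_right (by linarith) hd0
    _ = (2 * k / Real.pi) * (Real.pi * d) := by field_simp
    _ ≤ (2 * k / Real.pi) * _ := mul_le_mul_of_nonneg_left main (by positivity)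
    _ = _ := by rw [recoveryConst]; ring
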